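/- Let $\ell>0$ and $\nu(z)=e^{\ell(z+z^{-1})/2}$, $z\neq0$, so that $\nu(e^{i\theta})=e^{\ell\cos\theta}$ on the unit circle $\mathbb T$ (oriented positively). Let $\{\Phi_n\}_{n\ge0}$ be the monic orthogonal polynomials on $\mathbb T$, $\deg\Phi_n=n$, $$\int_{\mathbb T}\Phi_n(z)\overline{\Phi_m(z)}\,\frac{\nu(z)}{iz}\,dz=\kappa_n^{-2}\delta_{n,m},\qquad \kappa_n>0,$$ let $\Phi_n^*(z)=z^n\overline{\Phi_n(1/\bar z)}$ be the reciprocal polynomials, $\alpha_k=-\overline{\Phi_{k+1}(0)}$ for $k\ge-1$ (so $\alpha_{-1}=-1$) the Verblunsky coefficients, and $b_n=2\pi\kappa_n^2$. For $n\ge1$ and $z\in\mathbb C\setminus\mathbb T$ put $$G_n(z)=\frac1{2\pi i}\int_{\mathbb T}\frac{\Phi_n(t)}{t-z}\frac{\nu(t)}{t^n}\,dt,\qquad G_{n-1}^*(z)=\frac1{2\pi i}\int_{\mathbb T}\frac{\Phi_{n-1}^*(t)}{t-z}\frac{\nu(t)}{t^n}\,dt,$$ $$Y_n=\begin{bmatrix}\Phi_n&G_n\\-b_{n-1}\Phi_{n-1}^*&-b_{n-1}G_{n-1}^*\end{bmatrix},\qquad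 C_n(z)=\begin{bmatrix}z^{-n/2}\nu(z)^{1/2}&0\\0&z^{n/2}\nu(z)^{-1/2}\end{bmatrix},\qquad Z_n=Y_nC_n,\qquad M_n=Z_n'Z_n^{-1},$$ where $z^{1/2}$ and $\nu^{1/2}$ are any holomorphic branches on an open subset of $\mathbb C\setminus(\mathbb T\cup\{0\})$. Then the $\alpha_k$ are real and, for every $n\ge1$, the functions $G_n,G_{n-1}^*$ are holomorphic in $\mathbb C\setminus\mathbb T$, $\det Y_n=1$ there, and the following hold. (1) On $\mathbb C\setminus(\mathbb T\cup\{0\})$, for every choice of the branches, $z^2M_n(z)=\widetilde M_n(z)$, where $$\widetilde M_n(z)=\begin{bmatrix}\frac\ell4z^2+\frac n2z+\frac\ell4\big(\frac{b_{n-1}}{b_n}-\alpha_{n-1}^2\big)&-\frac{\ell}{2b_n}(\alpha_{n-1}-\alpha_nz)\\-\frac{\ell}{2}b_{n-1}(\alpha_{n-1}-\alpha_{n-2}z)&-\frac\ell4z^2-\frac n2z-\frac\ell4\big(\frac{b_{n-1}}{b_n}-\alpha_{n-1}^2\big)\end{bmatrix}.$$ (2) On $\mathbb C\setminus(\mathbb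 T\cup\{0\})$, $$z^2Y_n'=\widetilde M_nY_n-z^2Y_nC_n'C_n^{-1},$$ $$z^2Y_n''+2Y_n'\big(z^2C_n'C_n^{-1}+zI_2\big)+Y_n\big(z^2C_n''C_n^{-1}+2zC_n'C_n^{-1}\big)=\Big(\widetilde M_n'+\frac{\widetilde M_n^2}{z^2}\Big)Y_n.$$ (3) First-order relations (those for $\Phi_n,\Phi_{n-1}^*$ for all $z\in\mathbb C$, those for $G_n,G_{n-1}^*$ for all $z\in\mathbb C\setminus\mathbb T$): $$\begin{aligned} z^2\Phi_n'&=\big(nz+\tfrac\ell2-\tfrac\ell2\alpha_{n-1}^2\big)\Phi_n+\tfrac\ell2\tfrac{b_{n-1}}{b_n}(\alpha_{n-1}-\alpha_nz)\Phi_{n-1}^*,\\ z^2G_n'&=\big(\tfrac\ell2z^2-\tfrac\ell2\alpha_{n-1}^2\big)G_n+\tfrac\ell2\tfrac{b_{n-1}}{b_n}(\alpha_{n-1}-\alpha_nz)G_{n-1}^*,\\ z^2(\Phi_{n-1}^*)'&=\tfrac\ell2(\alpha_{n-1}-\alpha_{n-2}z)\Phi_n+\big(-\tfrac\ell2z^2+\tfrac\ell2\alpha_{n-1}^2\big)\Phi_{n-1}^*,\\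 z^2(G_{n-1}^*)'&=\tfrac\ell2(\alpha_{n-1}-\alpha_{n-2}z)G_n+\big(-nz-\tfrac\ell2+\tfrac\ell2\alpha_{n-1}^2\big)G_{n-1}^*. \end{aligned}$$ (4) Second-order relations, on the same domains, with $K_n=\frac{\ell^2}4\big((1-\alpha_{n-1}^2)\alpha_n\alpha_{n-2}-\alpha_{n-1}^2\big)$: $$\begin{aligned} z^2\Phi_n''+\big(\tfrac\ell2z^2+(2-n)z-\tfrac\ell2\big)\Phi_n'+\big(-\tfrac{\ell n}2z-\tfrac{\ell^2}4-n-K_n\big)\Phi_n&=-\tfrac\ell2(1-\alpha_{n-1}^2)\alpha_n\Phi_{n-1}^*,\\ z^2G_n''+\big(-\tfrac\ell2z^2+(n+2)z+\tfrac\ell2\big)G_n'-\big(\ell(\tfrac n2+1)z+\tfrac{\ell^2}4+K_n\big)G_n&=-\tfrac\ell2(1-\alpha_{n-1}^2)\alpha_nG_{n-1}^*,\\ z^2(\Phi_{n-1}^*)''+\big(\tfrac\ell2z^2+(2-n)z-\tfrac\ell2\big)(\Phi_{n-1}^*)'-\big(\ell(\tfrac n2-1)z+\tfrac{\ell^2}4+K_n\big)\Phi_{n-1}^*&=-\tfrac\ell2\alpha_{n-2}\Phi_n,\\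 z^2(G_{n-1}^*)''+\big(-\tfrac\ell2z^2+(n+2)z+\tfrac\ell2\big)(G_{n-1}^*)'-\big(\tfrac{\ell n}2z+\tfrac{\ell^2}4-n+K_n\big)G_{n-1}^*&=-\tfrac\ell2\alpha_{n-2}G_n. \end{aligned}$$ -/

import Mathlib

open Polynomial

noncomputable section

namespace ModifiedBessel

/-- The modified Bessel weight `ν(z) = exp (ℓ (z + 1/z) / 2)`; on the unit circle,
`ν(e^{iθ}) = e^{ℓ cos θ}`. -/
def weight (ℓ : ℝ) (z : ℂ) : ℂ :=
  Complex.exp ((ℓ : ℂ) * (z + z⁻¹) / 2)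

/-- The pairing `∫_𝕋 P(z) conj(Q(z)) ν(z) / (i z) dz`. -/
def pairing (ν : ℂ → ℂ) (P Q : ℂ[X]) : ℂ :=
  ∮ t in C(0, 1), P.eval t * (starRingEnd ℂ) (Q.eval t) * (ν t / (Complex.I * t))

/-- `Φ` is the sequence of monic orthogonal polynomials on the unit circle with respect to
`dμ(z) = ν(z) / (i z) dz`, and `κ n > 0` are the normalizing constants,
`∫ Φ_n conj(Φ_m) dμ = κ_n⁻² δ_{n,m}`. -/
structure IsMonicOPUC (ν : ℂ → ℂ) (Φ : ℕ → ℂ[X]) (κ : ℕ → ℝ) : Prop where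
  monic : ∀ n, (Φ n).Monic
  natDegree_eq : ∀ n, (Φ n).natDegree = n
  kappa_pos : ∀ n, 0 < κ n
  orthogonal : ∀ n m, pairing ν (Φ n) (Φ m) = if n = m then (((κ n) ^ 2)⁻¹ : ℂ) else 0

/-- On the unit circle, the pairing is the integral of `P conj(Q) e^{ℓ cos θ}` in the angle. -/
theorem pairing_weight (ℓ : ℝ) (P Q : ℂ[X]) :
    pairing (weight ℓ) P Q = ∫ θ in (0 : ℝ)..2 * Real.pi,
      P.eval (circleMap 0 1 θ) * (starRingEnd ℂ) (Q.eval (circleMap 0 1 θ)) *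
        (Real.exp (ℓ * Real.cos θ) : ℂ) := by
  unfold pairing circleIntegral
  refine intervalIntegral.integral_congr fun θ _ => ?_
  have h0 : circleMap 0 1 θ ≠ 0 := circleMap_ne_center one_ne_zero
  have hw : weight ℓ (circleMap 0 1 θ) = (Real.exp (ℓ * Real.cos θ) : ℂ) := by
    have : circleMap 0 1 θ + (circleMap 0 1 θ)⁻¹ = 2 * (Real.cos θ : ℂ) := by
      rw [circleMap_zero, Complex.ofReal_one, one_mul, ← Complex.exp_neg, Complex.ofReal_cos,
        Complex.two_cos, neg_mul]
    rw [weight, this, Complex.ofReal_exp]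
    congr 1
    push_cast
    ring
  simp only [deriv_circleMap, smul_eq_mul, hw]
  have hI := Complex.I_ne_zero
  field_simp

theorem pairing_integrable (ℓ : ℝ) (P Q : ℂ[X]) : IntervalIntegrable (fun θ : ℝ =>
      P.eval (circleMap 0 1 θ) * (starRingEnd ℂ) (Q.eval (circleMap 0 1 θ)) *
        (Real.exp (ℓ * Real.cos θ) : ℂ)) MeasureTheory.volume 0 (2 * Real.pi) := by
  refine Continuous.intervalIntegrable ?_ _ _
  have h1 : Continuous (fun θ : ℝ => circleMap 0 1 θ) := continuous_circleMap 0 1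
  have h2 := P.continuous.comp h1
  have h3 := Complex.continuous_conj.comp (Q.continuous.comp h1)
  exact (h2.mul h3).mul (by fun_prop)

theorem pairing_sub_left (ℓ : ℝ) (P P' Q : ℂ[X]) :
    pairing (weight ℓ) (P - P') Q = pairing (weight ℓ) P Q - pairing (weight ℓ) P' Q := by
  simp only [pairing_weight]
  rw [← intervalIntegral.integral_sub (pairing_integrable ℓ P Q) (pairing_integrable ℓ P' Q)]
  congr 1; ext θ; simp only [eval_sub]; ring

theorem pairing_C_mul_left (ℓ : ℝ) (c : ℂ) (P Q : ℂ[X]) :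
    pairing (weight ℓ) (C c * P) Q = c * pairing (weight ℓ) P Q := by
  simp only [pairing_weight]
  rw [← intervalIntegral.integral_const_mul]
  congr 1; ext θ; simp only [eval_mul, eval_C]; ring

theorem pairing_sum_left (ℓ : ℝ) {ι : Type} (s : Finset ι) (F : ι → ℂ[X]) (Q : ℂ[X]) :
    pairing (weight ℓ) (∑ i ∈ s, F i) Q = ∑ i ∈ s, pairing (weight ℓ) (F i) Q := by
  simp only [pairing_weight]
  rw [← intervalIntegral.integral_finsetSum fun i _ => pairing_integrable ℓ (F i) Q]
  congr 1; ext θ; simp only [eval_finsetSum, Finset.sum_mul]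

theorem pairing_conj (ℓ : ℝ) (P Q : ℂ[X]) :
    pairing (weight ℓ) Q P = (starRingEnd ℂ) (pairing (weight ℓ) P Q) := by
  simp only [pairing_weight, intervalIntegral]
  rw [map_sub, ← integral_conj, ← integral_conj]
  simp only [map_mul, Complex.conj_conj, Complex.conj_ofReal]
  congr 2 <;> ext θ <;> ring

theorem pairing_self_pos (ℓ : ℝ) (P : ℂ[X]) (hP : P ≠ 0) :
    ∃ r : ℝ, 0 < r ∧ pairing (weight ℓ) P P = r := by
  refine ⟨∫ θ in (0 : ℝ)..2 * Real.pi,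
    ‖P.eval (circleMap 0 1 θ)‖ ^ 2 * Real.exp (ℓ * Real.cos θ), ?_, ?_⟩
  · have hc : Continuous (fun θ : ℝ =>
        ‖P.eval (circleMap 0 1 θ)‖ ^ 2 * Real.exp (ℓ * Real.cos θ)) := by
      have h2 := P.continuous.comp (continuous_circleMap 0 1)
      exact (h2.norm.pow 2).mul (by fun_prop)
    obtain ⟨θ, hθ, hne⟩ : ∃ θ ∈ Set.Icc (0 : ℝ) (2 * Real.pi),
        P.eval (circleMap 0 1 θ) ≠ 0 := by
      by_contra! h
      apply hP
      apply Polynomial.eq_zero_of_infinite_isRoot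
      refine Set.Infinite.mono (s := (circleMap 0 1) '' Set.Ioo 0 (2 * Real.pi)) ?_ ?_
      · rintro _ ⟨θ, hθ, rfl⟩
        exact h θ (Set.Ioo_subset_Icc_self hθ)
      · refine Set.Infinite.image ?_ (Set.Ioo_infinite Real.two_pi_pos)
        refine (injOn_circleMap_of_abs_sub_le' (R := 1) (a := 0) (b := 2 * Real.pi)
          one_ne_zero (by simp)).mono Set.Ioo_subset_Ico_self
    refine intervalIntegral.integral_pos Real.two_pi_pos hc.continuousOn
      (fun x _ => by positivity) ⟨θ, hθ, by positivity⟩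
  · rw [pairing_weight, ← intervalIntegral.integral_ofReal]
    congr 1; ext θ
    rw [Complex.mul_conj, Complex.normSq_eq_norm_sq]
    push_cast; rfl

/-- Monic orthogonal polynomials for the modified Bessel weight exist. -/
theorem exists_isMonicOPUC (ℓ : ℝ) : ∃ Φ κ, IsMonicOPUC (weight ℓ) Φ κ := by
  let B := pairing (weight ℓ)
  let Φ : ℕ → ℂ[X] := fun n => Nat.strongRec (motive := fun _ => ℂ[X]) (fun n ih =>
    X ^ n - ∑ m : Fin n, C (B (X ^ n) (ih m m.2) / B (ih m m.2) (ih m m.2)) * ih m m.2) n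
  have hΦ : ∀ n, Φ n = X ^ n -
      ∑ m : Fin n, C (B (X ^ n) (Φ m) / B (Φ m) (Φ m)) * Φ m := by
    intro n
    simp only [Φ]
    conv_lhs => rw [Nat.strongRec]
  have hdeg : ∀ n, (Φ n).Monic ∧ (Φ n).natDegree = n := by
    intro n
    induction n using Nat.strong_induction_on with
    | _ n ih =>
      have hlt : (∑ m : Fin n, C (B (X ^ n) (Φ m) / B (Φ m) (Φ m)) * Φ m).degree < (n : ℕ) := by
        refine (degree_sum_le _ _).trans_lt ((Finset.sup_lt_iff (WithBot.bot_lt_coe n)).2 ?_)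
        intro m _
        rw [← smul_eq_C_mul]
        refine (degree_smul_le _ _).trans_lt ?_
        rw [degree_eq_natDegree (ih m m.2).1.ne_zero, (ih m m.2).2]
        exact WithBot.coe_lt_coe.2 m.2
      rw [hΦ n]
      have hlt' := hlt
      rw [← degree_X_pow (R := ℂ) n] at hlt'
      refine ⟨(monic_X_pow n).sub_of_left hlt', ?_⟩
      rw [natDegree_eq_of_degree_eq (degree_sub_eq_left_of_degree_lt hlt'), natDegree_X_pow]
  have hpos : ∀ n, ∃ r : ℝ, 0 < r ∧ B (Φ n) (Φ n) = r := fun n =>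
    pairing_self_pos ℓ _ (hdeg n).1.ne_zero
  choose r hr hB using hpos
  have hlt : ∀ n, ∀ m < n, B (Φ n) (Φ m) = 0 := by
    intro n
    induction n using Nat.strong_induction_on with
    | _ n ih =>
      intro m hm
      have hne : B (Φ m) (Φ m) ≠ 0 := by rw [hB]; exact_mod_cast (hr m).ne'
      rw [hΦ n]
      simp only [B, pairing_sub_left, pairing_sum_left, pairing_C_mul_left]
      rw [Finset.sum_eq_single (⟨m, hm⟩ : Fin n)]
      · exact sub_eq_zero.2 (div_mul_cancel₀ _ hne).symm
      · intro k _ hk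
        have hkm : (k : ℕ) ≠ m := fun h => hk (Fin.ext h)
        rcases lt_or_gt_of_ne hkm with h | h
        · rw [pairing_conj ℓ (Φ m) (Φ k), show pairing (weight ℓ) (Φ m) (Φ k) = 0 from ih m hm k h]; simp
        · rw [show pairing (weight ℓ) (Φ k) (Φ m) = 0 from ih k k.2 m h]; simp
      · simp
  refine ⟨Φ, fun n => (√(r n))⁻¹, fun n => (hdeg n).1, fun n => (hdeg n).2,
    fun n => by have := hr n; positivity, fun n m => ?_⟩
  split_ifs with h
  · subst h
    rw [show pairing (weight ℓ) (Φ n) (Φ n) = r n from hB n]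
    rw [← Complex.ofReal_pow, ← Complex.ofReal_inv, inv_pow, inv_inv, Real.sq_sqrt (hr n).le]
  · rcases lt_or_gt_of_ne h with h | h
    · rw [pairing_conj, show pairing (weight ℓ) (Φ m) (Φ n) = 0 from hlt m n h, map_zero]
    · exact hlt n m h

/-- The reciprocal polynomial `Φ_n^*(z) = z^n conj(Φ_n(1 / conj z))`. -/
def reciprocal (Φ : ℕ → ℂ[X]) (n : ℕ) : ℂ[X] :=
  ((Φ n).reflect n).map (starRingEnd ℂ)

/-- The Verblunsky coefficients `α_k = - conj(Φ_{k+1}(0))` for `k ≥ -1`; as `Φ_0 = 1`, this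
includes the convention `α_{-1} = -1`. -/
def verblunsky (Φ : ℕ → ℂ[X]) (k : ℤ) : ℂ :=
  -(starRingEnd ℂ) ((Φ (k + 1).toNat).eval 0)

/-- `b_n = 2 π κ_n²`. -/
def bCoeff (κ : ℕ → ℝ) (n : ℕ) : ℂ :=
  2 * (Real.pi : ℂ) * (κ n : ℂ) ^ 2

/-- `G_n(z) = (2πi)⁻¹ ∫_𝕋 Φ_n(t) / (t - z) · ν(t) / t^n dt`. -/
def G (ν : ℂ → ℂ) (Φ : ℕ → ℂ[X]) (n : ℕ) (z : ℂ) : ℂ :=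
  (2 * (Real.pi : ℂ) * Complex.I)⁻¹ *
    ∮ t in C(0, 1), (Φ n).eval t / (t - z) * (ν t / t ^ n)

/-- `G_m^*(z) = (2πi)⁻¹ ∫_𝕋 Φ_m^*(t) / (t - z) · ν(t) / t^{m+1} dt`. -/
def GStar (ν : ℂ → ℂ) (Φ : ℕ → ℂ[X]) (m : ℕ) (z : ℂ) : ℂ :=
  (2 * (Real.pi : ℂ) * Complex.I)⁻¹ *
    ∮ t in C(0, 1), (reciprocal Φ m).eval t / (t - z) * (ν t / t ^ (m + 1))

/-- The matrix `Y_n` (for `n ≥ 1`) that solves the Riemann--Hilbert problem. -/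
def Y (ν : ℂ → ℂ) (Φ : ℕ → ℂ[X]) (κ : ℕ → ℝ) (n : ℕ) (z : ℂ) : Matrix (Fin 2) (Fin 2) ℂ :=
  !![(Φ n).eval z, G ν Φ n z;
    -bCoeff κ (n - 1) * (reciprocal Φ (n - 1)).eval z, -bCoeff κ (n - 1) * GStar ν Φ (n - 1) z]

/-- `ρ` and `σ` are holomorphic branches of `z^{1/2}` and `ν(z)^{1/2}` on the open set `U`. -/
structure IsBranchPair (ν : ℂ → ℂ) (U : Set ℂ) (ρ σ : ℂ → ℂ) : Prop where
  isOpen : IsOpen U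
  diff_left : DifferentiableOn ℂ ρ U
  diff_right : DifferentiableOn ℂ σ U
  sq_left : ∀ z ∈ U, ρ z ^ 2 = z
  sq_right : ∀ z ∈ U, σ z ^ 2 = ν z

/-- `C_n(z) = diag (z^{-n/2} ν(z)^{1/2}, z^{n/2} ν(z)^{-1/2})` for the chosen branches `ρ` of
`z^{1/2}` and `σ` of `ν^{1/2}`. -/
def CMat (ρ σ : ℂ → ℂ) (n : ℕ) (z : ℂ) : Matrix (Fin 2) (Fin 2) ℂ :=
  !![σ z / ρ z ^ n, 0; 0, ρ z ^ n / σ z]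

/-- The fundamental matrix `Z_n = Y_n C_n`. -/
def Z (ν : ℂ → ℂ) (Φ : ℕ → ℂ[X]) (κ : ℕ → ℝ) (ρ σ : ℂ → ℂ) (n : ℕ) (z : ℂ) :
    Matrix (Fin 2) (Fin 2) ℂ :=
  Y ν Φ κ n z * CMat ρ σ n z

/-- The entrywise derivative of a matrix function of a complex variable. -/
def mderiv (F : ℂ → Matrix (Fin 2) (Fin 2) ℂ) (z : ℂ) : Matrix (Fin 2) (Fin 2) ℂ :=
  Matrix.of fun i j => deriv (fun w => F w i j) z

/-- The structure matrix `M_n = Z_n' Z_n⁻¹`. -/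
def M (ν : ℂ → ℂ) (Φ : ℕ → ℂ[X]) (κ : ℕ → ℝ) (ρ σ : ℂ → ℂ) (n : ℕ) (z : ℂ) :
    Matrix (Fin 2) (Fin 2) ℂ :=
  mderiv (Z ν Φ κ ρ σ n) z * (Z ν Φ κ ρ σ n z)⁻¹

/-- The explicit quadratic matrix polynomial that `z² M_n(z)` is claimed to be. -/
def MTilde (ℓ : ℝ) (Φ : ℕ → ℂ[X]) (κ : ℕ → ℝ) (n : ℕ) (z : ℂ) : Matrix (Fin 2) (Fin 2) ℂ :=
  let α : ℤ → ℂ := verblunsky Φ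
  let b : ℕ → ℂ := bCoeff κ
  !![(ℓ : ℂ) / 4 * z ^ 2 + n / 2 * z + ℓ / 4 * (b (n - 1) * (b n)⁻¹ - α (n - 1) ^ 2),
      -(ℓ : ℂ) / 2 * (b n)⁻¹ * (α (n - 1) - α n * z);
    -(ℓ : ℂ) / 2 * b (n - 1) * (α (n - 1) - α (n - 2) * z),
      -(ℓ : ℂ) / 4 * z ^ 2 - n / 2 * z - ℓ / 4 * (b (n - 1) * (b n)⁻¹ - α (n - 1) ^ 2)]

end ModifiedBessel

end

/-!
The pair `v = (Φ_{n+1}, Φ_n^*)` satisfies a linear system `z² v' = L(z) v` with a polynomial matrix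
`L`: integration by parts on the circle makes `z Φ_{n+1}' - (n + 1) Φ_{n+1}` orthogonal to all but
two of the powers `z^j`, `j ≤ n`, because `z² ν' / ν` is a quadratic polynomial, and this identifies
it as a combination of `Φ_n` and `Φ_n^*`. The same integration by parts turns this into the system
`z² v' = (L + S) v` for the functions of the second kind `(G_{n+1}, G_n^*)`, where `S` is `z²` times
the logarithmic derivative of `ν(z) / z^{n+1}`. Since `tr L = -S`, both systems are conjugate to
`± S / 2` plus the trace-free matrix `MTilde`, and `C_{n+1}` absorbs `± S / 2`.

By the discrete Painlevé II equation, `z²` divides `det L`. As moreover `det (L + S) = det L`, one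
elimination of the second component, in which this factor `z²` cancels, gives all four scalar
second-order equations, at `z = 0` as well.
-/

noncomputable section

namespace ModifiedBessel

open scoped ComplexConjugate Topology

/-! ### The pairing of polynomials on the unit circle -/

section Pairing

variable {ν : ℂ → ℂ}

theorem conj_eq_inv_of_mem_sphere {t : ℂ} (ht : t ∈ Metric.sphere (0 : ℂ) 1) : conj t = t⁻¹ := by
  rw [Complex.inv_def, Complex.normSq_eq_norm_sq, mem_sphere_zero_iff_norm.1 ht]
  simp

theorem ne_zero_of_mem_sphere {t : ℂ} (ht : t ∈ Metric.sphere (0 : ℂ) 1) : t ≠ 0 :=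
  Metric.ne_of_mem_sphere ht one_ne_zero

theorem pairing_congr {P Q P' Q' : ℂ[X]}
    (h : ∀ t ∈ Metric.sphere (0 : ℂ) 1,
      P.eval t * conj (Q.eval t) = P'.eval t * conj (Q'.eval t)) :
    pairing ν P Q = pairing ν P' Q' :=
  circleIntegral.integral_congr zero_le_one fun t ht => by simp only [h t ht]

theorem circleIntegrable_pairing (hν : CircleIntegrable ν 0 1) (P Q : ℂ[X]) :
    CircleIntegrable (fun t => P.eval t * conj (Q.eval t) * (ν t / (Complex.I * t))) 0 1 := by
  have hcont : ContinuousOn (fun t => P.eval t * conj (Q.eval t) * (Complex.I * t)⁻¹)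
      (Metric.sphere (0 : ℂ) |1|) := by
    refine ContinuousOn.mul (Continuous.continuousOn (by fun_prop))
      (ContinuousOn.inv₀ (by fun_prop) fun t ht => ?_)
    exact mul_ne_zero Complex.I_ne_zero (ne_zero_of_mem_sphere (by simpa using ht))
  refine (congrArg (CircleIntegrable · 0 1) (funext fun t => ?_)).mp (hν.continuousOn_mul hcont)
  rw [Pi.mul_apply, mul_assoc, div_eq_inv_mul]

/-- The pairing as a sesquilinear form on polynomials, linear in its first argument. -/
def pairingForm (hν : CircleIntegrable ν 0 1) : ℂ[X] →ₗ[ℂ] ℂ[X] →ₗ⋆[ℂ] ℂ :=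
  LinearMap.mk₂'ₛₗ (RingHom.id ℂ) (starRingEnd ℂ) (pairing ν)
    (fun P P' Q => by
      rw [pairing, pairing, pairing, ← circleIntegral.integral_add
        (circleIntegrable_pairing hν P Q) (circleIntegrable_pairing hν P' Q)]
      simp only [eval_add, add_mul])
    (fun c P Q => by
      rw [pairing, pairing, ← circleIntegral.integral_smul]
      simp only [eval_smul, smul_eq_mul, RingHom.id_apply, mul_assoc])
    (fun P Q Q' => by
      rw [pairing, pairing, pairing, ← circleIntegral.integral_add
        (circleIntegrable_pairing hν P Q) (circleIntegrable_pairing hν P Q')]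
      simp only [eval_add, map_add, add_mul, mul_add])
    (fun c P Q => by
      rw [pairing, pairing, ← circleIntegral.integral_smul]
      simp only [eval_smul, smul_eq_mul, map_mul, mul_assoc, mul_left_comm])

@[simp]
theorem pairingForm_apply (hν : CircleIntegrable ν 0 1) (P Q : ℂ[X]) :
    pairingForm hν P Q = pairing ν P Q :=
  rfl

theorem pairing_X_mul_X_mul (P Q : ℂ[X]) : pairing ν (X * P) (X * Q) = pairing ν P Q := by
  refine pairing_congr fun t ht => ?_
  have := ne_zero_of_mem_sphere ht
  simp only [eval_mul, eval_X, map_mul, conj_eq_inv_of_mem_sphere ht]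
  field_simp

theorem pairing_eq_intervalIntegral (P Q : ℂ[X]) :
    pairing ν P Q = ∫ θ in (0 : ℝ)..2 * Real.pi,
      P.eval (circleMap 0 1 θ) * conj (Q.eval (circleMap 0 1 θ)) * ν (circleMap 0 1 θ) := by
  refine intervalIntegral.integral_congr fun θ _ => ?_
  have h0 : circleMap 0 1 θ ≠ 0 := circleMap_ne_center one_ne_zero
  have hI := Complex.I_ne_zero
  simp only [deriv_circleMap, smul_eq_mul]
  field_simp

theorem circleMap_two_pi_sub (θ : ℝ) : circleMap 0 1 (2 * Real.pi - θ) = (circleMap 0 1 θ)⁻¹ := by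
  rw [sub_eq_neg_add, periodic_circleMap 0 1 (-θ), circleMap_zero_inv, inv_one]

theorem eval_map_conj (P : ℂ[X]) (z : ℂ) : (P.map conj).eval z = conj (P.eval (conj z)) := by
  rw [eval_map, ← eval₂_hom, Complex.conj_conj]

theorem pairing_map_conj (hsymm : ∀ t ∈ Metric.sphere (0 : ℂ) 1, ν t⁻¹ = ν t) (P Q : ℂ[X]) :
    pairing ν (P.map conj) (Q.map conj) = pairing ν Q P := by
  have key := intervalIntegral.integral_comp_sub_left (a := 0) (b := 2 * Real.pi)
    (fun θ => Q.eval (circleMap 0 1 θ) * conj (P.eval (circleMap 0 1 θ)) * ν (circleMap 0 1 θ))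
    (2 * Real.pi)
  rw [sub_self, sub_zero] at key
  rw [pairing_eq_intervalIntegral, pairing_eq_intervalIntegral, ← key]
  refine intervalIntegral.integral_congr fun θ _ => ?_
  have hθ := circleMap_mem_sphere (0 : ℂ) zero_le_one θ
  simp only [eval_map_conj, conj_eq_inv_of_mem_sphere hθ, Complex.conj_conj,
    circleMap_two_pi_sub, hsymm _ hθ]
  ring

end Pairing

/-! ### Reversed polynomials -/

section ConjReflect

/-- The polynomial `z ^ N * conj (P (1 / conj z))`, for `P` of degree at most `N`. -/
def conjReflect (N : ℕ) (P : ℂ[X]) : ℂ[X] :=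
  (P.reflect N).map conj

variable {N : ℕ} {P Q : ℂ[X]}

theorem coeff_conjReflect (N : ℕ) (P : ℂ[X]) (k : ℕ) :
    (conjReflect N P).coeff k = conj (P.coeff (revAt N k)) := by
  rw [conjReflect, coeff_map, coeff_reflect]

theorem natDegree_conjReflect_le (hP : P.natDegree ≤ N) : (conjReflect N P).natDegree ≤ N :=
  natDegree_map_le.trans (by simpa [hP] using natDegree_reflect_le (p := P) (N := N))

theorem conjReflect_conjReflect (N : ℕ) (P : ℂ[X]) : conjReflect N (conjReflect N P) = P := by
  rw [conjReflect, conjReflect, reflect_map, reflect_reflect, Polynomial.map_map]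
  simp

theorem conjReflect_sub (N : ℕ) (P Q : ℂ[X]) :
    conjReflect N (P - Q) = conjReflect N P - conjReflect N Q := by
  simp only [conjReflect, reflect_sub, Polynomial.map_sub]

theorem conjReflect_C_mul (N : ℕ) (c : ℂ) (P : ℂ[X]) :
    conjReflect N (C c * P) = C (conj c) * conjReflect N P := by
  simp only [conjReflect, reflect_C_mul, Polynomial.map_mul, map_C]

theorem conjReflect_succ_X_mul (hP : P.natDegree ≤ N) :
    conjReflect (N + 1) (X * P) = conjReflect N P := by
  rw [conjReflect, add_comm N 1, reflect_mul X P natDegree_X_le hP, reflect_one_X, one_mul]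
  rfl

theorem conjReflect_succ (hP : P.natDegree ≤ N) :
    conjReflect (N + 1) P = X * conjReflect N P := by
  rw [← conjReflect_conjReflect (N + 1) (X * conjReflect N P),
    conjReflect_succ_X_mul (natDegree_conjReflect_le hP), conjReflect_conjReflect]

theorem conjReflect_X_pow {j : ℕ} (hj : j ≤ N) : conjReflect N (X ^ j) = X ^ (N - j) := by
  rw [conjReflect, reflect_monomial, revAt_le hj, Polynomial.map_pow, map_X]

theorem coeff_X_mul_derivative {R : Type*} [CommSemiring R] (P : R[X]) (k : ℕ) :
    (X * derivative P).coeff k = k * P.coeff k := by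
  rcases k with _ | k
  · simp
  · rw [coeff_X_mul, coeff_derivative, mul_comm, Nat.cast_succ]

theorem natDegree_X_mul_derivative_sub_le {R : Type*} [CommRing R] {P : R[X]} {n : ℕ}
    (hP : P.natDegree ≤ n + 1) :
    (X * derivative P - C ((n : R) + 1) * P).natDegree ≤ n := by
  refine natDegree_le_iff_coeff_eq_zero.2 fun k hk => ?_
  rw [coeff_sub, coeff_X_mul_derivative, coeff_C_mul, ← sub_mul]
  rcases (Nat.succ_le_of_lt hk).eq_or_lt with rfl | hlt
  · rw [Nat.cast_succ, sub_self, zero_mul]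
  · rw [coeff_eq_zero_of_natDegree_lt (hP.trans_lt hlt), mul_zero]

theorem X_mul_derivative_conjReflect (hP : P.natDegree ≤ N) :
    X * derivative (conjReflect N P) = conjReflect N (C (N : ℂ) * P - X * derivative P) := by
  ext k
  rw [coeff_X_mul_derivative, coeff_conjReflect, coeff_conjReflect, coeff_sub, coeff_C_mul,
    coeff_X_mul_derivative]
  rcases le_or_gt k N with hk | hk
  · rw [revAt_le hk, Nat.cast_sub hk, ← sub_mul, sub_sub_cancel, map_mul, Complex.conj_natCast]
  · rw [revAt_eq_self_of_lt hk, coeff_eq_zero_of_natDegree_lt (hP.trans_lt hk)]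
    simp

theorem eval_conjReflect (hP : P.natDegree ≤ N) {t : ℂ} (ht : t ∈ Metric.sphere (0 : ℂ) 1) :
    (conjReflect N P).eval t = t ^ N * conj (P.eval t) := by
  have h0 := ne_zero_of_mem_sphere ht
  have := invertibleOfNonzero (inv_ne_zero h0)
  have h := eval₂_reflect_mul_pow conj t⁻¹ N P hP
  rw [invOf_eq_inv, inv_inv, ← conj_eq_inv_of_mem_sphere ht, eval₂_hom,
    conj_eq_inv_of_mem_sphere ht, inv_pow] at h
  rw [conjReflect, eval_map, ← h]
  field_simp

theorem pairing_conjReflect {ν : ℂ → ℂ} (hP : P.natDegree ≤ N) (hQ : Q.natDegree ≤ N) :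
    pairing ν (conjReflect N P) (conjReflect N Q) = pairing ν Q P := by
  refine pairing_congr fun t ht => ?_
  have := ne_zero_of_mem_sphere ht
  simp only [eval_conjReflect hP ht, eval_conjReflect hQ ht, map_mul, map_pow,
    conj_eq_inv_of_mem_sphere ht, Complex.conj_conj, inv_pow]
  field_simp

theorem pairing_mul_X_pow {ν : ℂ → ℂ} (hQ : Q.natDegree ≤ N) (P : ℂ[X]) :
    pairing ν (Q * P) (X ^ N) = pairing ν P (conjReflect N Q) := by
  refine pairing_congr fun t ht => ?_
  simp only [eval_conjReflect hQ ht, eval_mul, eval_pow, eval_X, map_mul, Complex.conj_conj]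
  ring

theorem eval_zero_conjReflect (N : ℕ) (P : ℂ[X]) : (conjReflect N P).eval 0 = conj (P.coeff N) := by
  rw [← coeff_zero_eq_eval_zero, coeff_conjReflect, revAt_zero]

end ConjReflect

/-! ### Monic orthogonal polynomials -/

theorem map_eq_coeff_smul_of_monic {R S M : Type*} [CommRing R] [Semiring S] [AddCommGroup M]
    [Module S M] {σ : R →+* S} {Φ : ℕ → R[X]} (hmonic : ∀ n, (Φ n).Monic)
    (hdeg : ∀ n, (Φ n).natDegree = n) (f : R[X] →ₛₗ[σ] M) {n : ℕ} (hf : ∀ m < n, f (Φ m) = 0)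
    {Q : R[X]} (hQ : Q.natDegree ≤ n) : f Q = σ (Q.coeff n) • f (Φ n) := by
  have coeff_self (m : ℕ) : (Φ m).coeff m = 1 := by
    simpa only [hdeg] using (hmonic m).coeff_natDegree
  induction n generalizing Q with
  | zero =>
    have hΦ : Φ 0 = 1 := (hmonic 0).natDegree_eq_zero.1 (hdeg 0)
    conv_lhs => rw [eq_C_of_natDegree_le_zero hQ, ← mul_one (C _), ← hΦ, ← smul_eq_C_mul]
    exact f.map_smulₛₗ _ _
  | succ n ih =>
    have hR : (Q - Q.coeff (n + 1) • Φ (n + 1)).natDegree ≤ n := by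
      refine natDegree_le_iff_coeff_eq_zero.2 fun k hk => ?_
      rcases (Nat.succ_le_of_lt hk).eq_or_lt with rfl | hk
      · simp [coeff_self]
      · rw [coeff_sub, coeff_smul, coeff_eq_zero_of_natDegree_lt (hQ.trans_lt hk),
          coeff_eq_zero_of_natDegree_lt ((hdeg _).trans_lt hk), smul_zero, sub_zero]
    have h := ih (fun m hm => hf m (hm.trans n.lt_succ_self)) hR
    rw [hf n n.lt_succ_self, smul_zero, map_sub, f.map_smulₛₗ] at h
    exact sub_eq_zero.1 h

theorem two_pi_ne_zero : 2 * (Real.pi : ℂ) ≠ 0 :=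
  mul_ne_zero two_ne_zero (Complex.ofReal_ne_zero.2 Real.pi_ne_zero)

theorem verblunsky_natCast (Φ : ℕ → ℂ[X]) (n : ℕ) :
    verblunsky Φ n = -conj ((Φ (n + 1)).eval 0) :=
  rfl

theorem verblunsky_natCast_sub_one (Φ : ℕ → ℂ[X]) (n : ℕ) :
    verblunsky Φ (n - 1) = -conj ((Φ n).eval 0) := by
  rw [verblunsky, sub_add_cancel, Int.toNat_natCast]

namespace IsMonicOPUC

variable {ν : ℂ → ℂ} {Φ : ℕ → ℂ[X]} {κ : ℕ → ℝ} {n : ℕ}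

theorem kappa_ne_zero (hΦ : IsMonicOPUC ν Φ κ) (n : ℕ) : (κ n : ℂ) ≠ 0 :=
  Complex.ofReal_ne_zero.2 (hΦ.kappa_pos n).ne'

theorem coeff_self (hΦ : IsMonicOPUC ν Φ κ) (n : ℕ) : (Φ n).coeff n = 1 := by
  simpa only [hΦ.natDegree_eq] using (hΦ.monic n).coeff_natDegree

theorem eq_one (hΦ : IsMonicOPUC ν Φ κ) : Φ 0 = 1 :=
  (hΦ.monic 0).natDegree_eq_zero.1 (hΦ.natDegree_eq 0)

theorem eval_zero_reciprocal (hΦ : IsMonicOPUC ν Φ κ) (n : ℕ) : (reciprocal Φ n).eval 0 = 1 := by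
  rw [← map_one conj, ← hΦ.coeff_self n]
  exact eval_zero_conjReflect n (Φ n)

theorem natDegree_reciprocal_le (hΦ : IsMonicOPUC ν Φ κ) (n : ℕ) :
    (reciprocal Φ n).natDegree ≤ n :=
  natDegree_conjReflect_le (hΦ.natDegree_eq n).le

theorem pairing_right (hν : CircleIntegrable ν 0 1) (hΦ : IsMonicOPUC ν Φ κ) {Q : ℂ[X]}
    (hQ : Q.natDegree ≤ n) : pairing ν (Φ n) Q = conj (Q.coeff n) * ((κ n : ℂ) ^ 2)⁻¹ := by
  have h := map_eq_coeff_smul_of_monic hΦ.monic hΦ.natDegree_eq (pairingForm hν (Φ n))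
    (fun m hm => (hΦ.orthogonal n m).trans (if_neg hm.ne')) hQ
  simpa only [pairingForm_apply, hΦ.orthogonal, if_true, smul_eq_mul] using h

theorem pairing_left (hν : CircleIntegrable ν 0 1) (hΦ : IsMonicOPUC ν Φ κ) {Q : ℂ[X]}
    (hQ : Q.natDegree ≤ n) : pairing ν Q (Φ n) = Q.coeff n * ((κ n : ℂ) ^ 2)⁻¹ := by
  have h := map_eq_coeff_smul_of_monic hΦ.monic hΦ.natDegree_eq ((pairingForm hν).flip (Φ n))
    (fun m hm => (hΦ.orthogonal m n).trans (if_neg hm.ne)) hQ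
  simpa only [LinearMap.flip_apply, pairingForm_apply, hΦ.orthogonal, if_true, smul_eq_mul,
    RingHom.id_apply] using h

theorem pairing_right_eq_zero (hν : CircleIntegrable ν 0 1) (hΦ : IsMonicOPUC ν Φ κ) {Q : ℂ[X]}
    (hQ : Q.natDegree < n) : pairing ν (Φ n) Q = 0 := by
  rw [hΦ.pairing_right hν hQ.le, coeff_eq_zero_of_natDegree_lt hQ, map_zero, zero_mul]

theorem pairing_left_eq_zero (hν : CircleIntegrable ν 0 1) (hΦ : IsMonicOPUC ν Φ κ) {Q : ℂ[X]}
    (hQ : Q.natDegree < n) : pairing ν Q (Φ n) = 0 := by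
  rw [hΦ.pairing_left hν hQ.le, coeff_eq_zero_of_natDegree_lt hQ, zero_mul]

theorem eq_zero_of_pairing_X_pow_eq_zero (hν : CircleIntegrable ν 0 1) (hΦ : IsMonicOPUC ν Φ κ)
    {P : ℂ[X]} (hdeg : P.degree < n) (hP : ∀ j < n, pairing ν P (X ^ j) = 0) : P = 0 := by
  by_contra hne
  have hlt : P.natDegree < n := (natDegree_lt_iff_degree_lt hne).2 hdeg
  have h := map_eq_coeff_smul_of_monic monic_X_pow natDegree_X_pow (pairingForm hν P)
    (fun j hj => hP j (hj.trans hlt)) (hΦ.natDegree_eq P.natDegree).le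
  rw [pairingForm_apply, pairingForm_apply, hP _ hlt, smul_zero, hΦ.pairing_left hν le_rfl] at h
  exact mul_ne_zero (leadingCoeff_ne_zero.2 hne)
    (inv_ne_zero (pow_ne_zero 2 (hΦ.kappa_ne_zero _))) h

theorem eq_C_mul_of_pairing_X_pow_eq_zero (hν : CircleIntegrable ν 0 1)
    (hΦ : IsMonicOPUC ν Φ κ) {P : ℂ[X]} (hdeg : P.natDegree ≤ n)
    (hP : ∀ j < n, pairing ν P (X ^ j) = 0) : P = C (P.coeff n) * Φ n := by
  rw [← smul_eq_C_mul]
  refine sub_eq_zero.1 (hΦ.eq_zero_of_pairing_X_pow_eq_zero hν (n := n) ?_ fun j hj => ?_)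
  · refine (degree_lt_iff_coeff_zero _ _).2 fun k hk => ?_
    rcases hk.eq_or_lt with rfl | hk
    · rw [coeff_sub, coeff_smul, hΦ.coeff_self, smul_eq_mul, mul_one, sub_self]
    · rw [coeff_sub, coeff_smul, coeff_eq_zero_of_natDegree_lt (hdeg.trans_lt hk),
        coeff_eq_zero_of_natDegree_lt ((hΦ.natDegree_eq n).trans_lt hk), smul_zero, sub_zero]
  · rw [← pairingForm_apply hν, map_sub, map_smul, LinearMap.sub_apply, LinearMap.smul_apply,
      pairingForm_apply, pairingForm_apply, hP j hj,
      hΦ.pairing_right_eq_zero hν ((natDegree_X_pow_le j).trans_lt hj), smul_zero, sub_zero]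

theorem map_conj_eq (hν : CircleIntegrable ν 0 1) (hΦ : IsMonicOPUC ν Φ κ)
    (hsymm : ∀ t ∈ Metric.sphere (0 : ℂ) 1, ν t⁻¹ = ν t) (n : ℕ) : (Φ n).map conj = Φ n := by
  have h := hΦ.eq_C_mul_of_pairing_X_pow_eq_zero hν (P := (Φ n).map conj) (n := n)
    (natDegree_map_le.trans (hΦ.natDegree_eq n).le) fun j hj => by
      rw [← map_X conj, ← Polynomial.map_pow, pairing_map_conj hsymm]
      exact hΦ.pairing_left_eq_zero hν ((natDegree_X_pow_le j).trans_lt hj)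
  rwa [coeff_map, hΦ.coeff_self, map_one, C_1, one_mul] at h

theorem conj_verblunsky (hν : CircleIntegrable ν 0 1) (hΦ : IsMonicOPUC ν Φ κ)
    (hsymm : ∀ t ∈ Metric.sphere (0 : ℂ) 1, ν t⁻¹ = ν t) (k : ℤ) :
    conj (verblunsky Φ k) = verblunsky Φ k := by
  have h := eval_map_conj (Φ (k + 1).toNat) 0
  rw [hΦ.map_conj_eq hν hsymm, map_zero] at h
  rw [verblunsky, ← h, map_neg, ← h]

theorem succ_eq (hν : CircleIntegrable ν 0 1) (hΦ : IsMonicOPUC ν Φ κ) (n : ℕ) :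
    Φ (n + 1) = X * Φ n - C (conj (verblunsky Φ n)) * reciprocal Φ n := by
  set R := Φ (n + 1) - X * Φ n with hR
  have hdeg : R.natDegree ≤ n := by
    refine natDegree_le_iff_coeff_eq_zero.2 fun k hk => ?_
    obtain ⟨k, rfl⟩ := Nat.exists_eq_succ_of_ne_zero (Nat.ne_zero_of_lt hk)
    rw [hR, coeff_sub, coeff_X_mul]
    rcases (Nat.lt_succ_iff.1 hk).eq_or_lt with rfl | hk
    · rw [hΦ.coeff_self, hΦ.coeff_self, sub_self]
    · rw [coeff_eq_zero_of_natDegree_lt ((hΦ.natDegree_eq _).trans_lt (Nat.succ_lt_succ hk)),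
        coeff_eq_zero_of_natDegree_lt ((hΦ.natDegree_eq _).trans_lt hk), sub_self]
  have horth (j : ℕ) (hj : j < n) : pairing ν (conjReflect n R) (X ^ j) = 0 := by
    obtain ⟨i, hi⟩ := Nat.exists_eq_add_of_lt hj
    rw [← conjReflect_conjReflect n (X ^ j), conjReflect_X_pow hj.le, pairing_conjReflect hdeg
      ((natDegree_X_pow_le _).trans (Nat.sub_le n j)), show n - j = i + 1 by omega,
      ← pairingForm_apply hν, hR, map_sub, pairingForm_apply, pairingForm_apply,
      hΦ.pairing_left_eq_zero hν ((natDegree_X_pow_le _).trans_lt (by omega)), pow_succ',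
      pairing_X_mul_X_mul,
      hΦ.pairing_left_eq_zero hν ((natDegree_X_pow_le _).trans_lt (by omega)), sub_zero]
  have hrefl := hΦ.eq_C_mul_of_pairing_X_pow_eq_zero hν (natDegree_conjReflect_le hdeg) horth
  have hcoeff : (conjReflect n R).coeff n = -verblunsky Φ n := by
    rw [coeff_conjReflect, revAt_le le_rfl, Nat.sub_self, coeff_zero_eq_eval_zero, hR, eval_sub,
      eval_mul, eval_X, zero_mul, sub_zero, verblunsky_natCast, neg_neg]
  have hRΦ : R = -(C (conj (verblunsky Φ n)) * reciprocal Φ n) := by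
    rw [← conjReflect_conjReflect n R, hrefl, hcoeff, conjReflect_C_mul, map_neg, C_neg, neg_mul]
    rfl
  rw [sub_eq_add_neg, ← hRΦ, hR, add_sub_cancel]

theorem reciprocal_succ_eq (hν : CircleIntegrable ν 0 1) (hΦ : IsMonicOPUC ν Φ κ) (n : ℕ) :
    reciprocal Φ (n + 1) = reciprocal Φ n - C (verblunsky Φ n) * (X * Φ n) := by
  have h := congrArg (conjReflect (n + 1)) (hΦ.succ_eq hν n)
  rw [conjReflect_sub, conjReflect_succ_X_mul (hΦ.natDegree_eq n).le, conjReflect_C_mul,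
    conjReflect_succ (hΦ.natDegree_reciprocal_le n), Complex.conj_conj] at h
  rw [show Φ n = conjReflect n (reciprocal Φ n) from (conjReflect_conjReflect n _).symm]
  exact h

theorem pairing_reciprocal (hν : CircleIntegrable ν 0 1) (hΦ : IsMonicOPUC ν Φ κ) {Q : ℂ[X]}
    (hQ : Q.natDegree ≤ n) :
    pairing ν (reciprocal Φ n) Q = conj (Q.coeff 0) * ((κ n : ℂ) ^ 2)⁻¹ := by
  rw [← conjReflect_conjReflect n Q]
  refine (pairing_conjReflect (hΦ.natDegree_eq n).le (natDegree_conjReflect_le hQ)).trans ?_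
  rw [hΦ.pairing_left hν (natDegree_conjReflect_le hQ), conjReflect_conjReflect,
    coeff_conjReflect, revAt_le le_rfl, Nat.sub_self]

theorem inv_kappa_sq_succ (hν : CircleIntegrable ν 0 1) (hΦ : IsMonicOPUC ν Φ κ) (n : ℕ) :
    ((κ (n + 1) : ℂ) ^ 2)⁻¹ =
      (1 - verblunsky Φ n * conj (verblunsky Φ n)) * ((κ n : ℂ) ^ 2)⁻¹ := by
  have hXΦ : (X * Φ n).natDegree ≤ n + 1 :=
    natDegree_mul_le_of_le natDegree_X_le (hΦ.natDegree_eq n).le |>.trans_eq (add_comm 1 n)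
  have hnorm := hΦ.pairing_left hν hXΦ
  have horth := hΦ.pairing_right_eq_zero hν (Nat.lt_succ_of_le (hΦ.natDegree_reciprocal_le n))
  have hself := hΦ.pairing_reciprocal hν (hΦ.natDegree_reciprocal_le n)
  rw [coeff_X_mul, hΦ.coeff_self, one_mul] at hnorm
  rw [coeff_zero_eq_eval_zero, hΦ.eval_zero_reciprocal, map_one, one_mul] at hself
  rw [hΦ.succ_eq hν, ← smul_eq_C_mul, ← pairingForm_apply hν] at hnorm horth
  simp only [map_sub, LinearMap.sub_apply, LinearMap.map_smulₛₗ, LinearMap.smul_apply,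
    Complex.conj_conj, pairingForm_apply, pairing_X_mul_X_mul, hΦ.orthogonal, hself, if_true,
    smul_eq_mul, RingHom.id_apply] at hnorm horth
  linear_combination -hnorm - verblunsky Φ n * horth

theorem bCoeff_ne_zero (hΦ : IsMonicOPUC ν Φ κ) (n : ℕ) : bCoeff κ n ≠ 0 :=
  mul_ne_zero two_pi_ne_zero (pow_ne_zero 2 (hΦ.kappa_ne_zero n))

theorem bCoeff_mul_inv_bCoeff_succ (hν : CircleIntegrable ν 0 1) (hΦ : IsMonicOPUC ν Φ κ)
    (n : ℕ) :
    bCoeff κ n * (bCoeff κ (n + 1))⁻¹ = 1 - verblunsky Φ n * conj (verblunsky Φ n) := by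
  have hκ := hΦ.kappa_ne_zero n
  rw [bCoeff, bCoeff, mul_inv (2 * (Real.pi : ℂ)), hΦ.inv_kappa_sq_succ hν]
  field_simp

end IsMonicOPUC

/-! ### Cauchy transforms over a circle -/

/-- The Cauchy transform `(2πi)⁻¹ ∮ f t / (t - z) dt` of a density `f` on the circle of radius
`R` about `c`. -/
def cauchyTransform (c : ℂ) (R : ℝ) (f : ℂ → ℂ) (z : ℂ) : ℂ :=
  (2 * (Real.pi : ℂ) * Complex.I)⁻¹ * ∮ t in C(c, R), f t / (t - z)

section CauchyTransform

variable {c z : ℂ} {R : ℝ} {f f' g : ℂ → ℂ}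

theorem sub_ne_zero_of_mem_sphere {t : ℂ} (ht : t ∈ Metric.sphere c R)
    (hz : z ∉ Metric.sphere c R) : t - z ≠ 0 :=
  sub_ne_zero.2 fun h => hz (h ▸ ht)

theorem circleIntegrable_div_sub_pow (hR : 0 ≤ R) (hf : CircleIntegrable f c R)
    (hz : z ∉ Metric.sphere c R) (k : ℕ) : CircleIntegrable (fun t => f t / (t - z) ^ k) c R := by
  have hcont : ContinuousOn (fun t => ((t - z) ^ k)⁻¹) (Metric.sphere c |R|) := by
    rw [abs_of_nonneg hR]
    exact ContinuousOn.inv₀ (by fun_prop) fun t ht =>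
      pow_ne_zero k (sub_ne_zero_of_mem_sphere ht hz)
  refine (congrArg (CircleIntegrable · c R) (funext fun t => ?_)).mp (hf.mul_continuousOn hcont)
  rw [Pi.mul_apply, div_eq_mul_inv]

theorem circleIntegrable_div_sub (hR : 0 ≤ R) (hf : CircleIntegrable f c R)
    (hz : z ∉ Metric.sphere c R) : CircleIntegrable (fun t => f t / (t - z)) c R := by
  simpa only [pow_one] using circleIntegrable_div_sub_pow hR hf hz 1

theorem exists_pos_forall_le_norm_sub (hz : z ∉ Metric.sphere c R) :
    ∃ ε > 0, ∀ w ∈ Metric.ball z ε, ∀ t ∈ Metric.sphere c R, ε ≤ ‖t - w‖ := by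
  obtain ⟨ε, hε, hball⟩ := Metric.isOpen_iff.1 Metric.isClosed_sphere.isOpen_compl z hz
  refine ⟨ε / 2, half_pos hε, fun w hw t ht => ?_⟩
  by_contra! h
  refine hball (a := t) ?_ ht
  rw [← dist_eq_norm] at h
  rw [Metric.mem_ball] at hw ⊢
  linarith [dist_triangle t w z]

theorem hasDerivAt_cauchyTransform (hR : 0 ≤ R) (hf : CircleIntegrable f c R)
    (hz : z ∉ Metric.sphere c R) :
    HasDerivAt (cauchyTransform c R f)
      ((2 * (Real.pi : ℂ) * Complex.I)⁻¹ * ∮ t in C(c, R), f t / (t - z) ^ 2) z := by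
  obtain ⟨ε, hε, hdist⟩ := exists_pos_forall_le_norm_sub hz
  have hmem (θ : ℝ) : circleMap c R θ ∈ Metric.sphere c R := circleMap_mem_sphere c hR θ
  have hnotMem {w : ℂ} (hw : w ∈ Metric.ball z ε) : w ∉ Metric.sphere c R := fun h => by
    simpa using hε.trans_le (hdist w hw w h)
  have hmeas {w : ℂ} (hw : w ∈ Metric.ball z ε) (k : ℕ) := (intervalIntegrable_iff.1
    (circleIntegrable_div_sub_pow hR hf (hnotMem hw) k).out).aestronglyMeasurable
  refine ((intervalIntegral.hasDerivAt_integral_of_dominated_loc_of_deriv_le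
    (bound := fun θ => R * (‖f (circleMap c R θ)‖ / ε ^ 2))
    (F := fun w θ => deriv (circleMap c R) θ • (f (circleMap c R θ) / (circleMap c R θ - w)))
    (F' := fun w θ => deriv (circleMap c R) θ • (f (circleMap c R θ) / (circleMap c R θ - w) ^ 2))
    (Metric.ball_mem_nhds z hε) ?_ ?_ ?_ ?_ ?_ ?_).2).const_mul _
  · filter_upwards [Metric.ball_mem_nhds z hε] with w hw
    simpa only [pow_one] using hmeas hw 1
  · exact (circleIntegrable_div_sub hR hf hz).out
  · exact hmeas (Metric.mem_ball_self hε) 2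
  · refine Filter.Eventually.of_forall fun θ _ w hw => ?_
    have hderiv : ‖deriv (circleMap c R) θ‖ = R := by simp [deriv_circleMap, abs_of_nonneg hR]
    rw [norm_smul, hderiv, norm_div, norm_pow]
    gcongr
    exact hdist w hw _ (hmem θ)
  · exact (hf.norm.div_const _).const_mul _
  · refine Filter.Eventually.of_forall fun θ _ w hw => ?_
    have h := ((hasDerivAt_const w (f (circleMap c R θ))).div
      ((hasDerivAt_const w (circleMap c R θ)).sub (hasDerivAt_id w))
        (sub_ne_zero_of_mem_sphere (hmem θ) (hnotMem hw))).const_smul (deriv (circleMap c R) θ)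
    exact h.congr_deriv (by simp)

theorem cauchyTransform_congr (hR : 0 ≤ R) (h : ∀ t ∈ Metric.sphere c R, f t = g t) (z : ℂ) :
    cauchyTransform c R f z = cauchyTransform c R g z :=
  congrArg _ (circleIntegral.integral_congr hR fun t ht => by simp only [h t ht])

theorem cauchyTransform_add (hR : 0 ≤ R) (hf : CircleIntegrable f c R)
    (hg : CircleIntegrable g c R) (hz : z ∉ Metric.sphere c R) :
    cauchyTransform c R (fun t => f t + g t) z =
      cauchyTransform c R f z + cauchyTransform c R g z := by
  simp only [cauchyTransform, add_div]
  rw [← mul_add, ← circleIntegral.integral_add (circleIntegrable_div_sub hR hf hz)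
    (circleIntegrable_div_sub hR hg hz)]

theorem cauchyTransform_const_mul (a : ℂ) (f : ℂ → ℂ) (z : ℂ) :
    cauchyTransform c R (fun t => a * f t) z = a * cauchyTransform c R f z := by
  simp only [cauchyTransform, mul_div_assoc, circleIntegral.integral_const_mul, mul_left_comm a]

theorem cauchyTransform_sub_mul (hR : 0 ≤ R) (hz : z ∉ Metric.sphere c R) (f : ℂ → ℂ) :
    cauchyTransform c R (fun t => (t - z) * f t) z =
      (2 * (Real.pi : ℂ) * Complex.I)⁻¹ * ∮ t in C(c, R), f t := by
  refine congrArg _ (circleIntegral.integral_congr hR fun t ht => ?_)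
  exact mul_div_cancel_left₀ _ (sub_ne_zero_of_mem_sphere ht hz)

/-- Integration by parts moves the derivative of the Cauchy kernel onto the density. -/
theorem hasDerivAt_cauchyTransform_of_hasDerivAt (hR : 0 ≤ R) (hz : z ∉ Metric.sphere c R)
    (hf : ∀ t ∈ Metric.sphere c R, HasDerivAt f (f' t) t) (hf' : CircleIntegrable f' c R) :
    HasDerivAt (cauchyTransform c R f) (cauchyTransform c R f' z) z := by
  have hfint : CircleIntegrable f c R := ContinuousOn.circleIntegrable hR fun t ht =>
    (hf t ht).continuousAt.continuousWithinAt
  have hparts := circleIntegral.integral_eq_zero_of_hasDerivWithinAt hR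
    (f := fun t => f t / (t - z)) (f' := fun t => f' t / (t - z) - f t / (t - z) ^ 2) fun t ht => by
      have hne := sub_ne_zero_of_mem_sphere ht hz
      refine (((hf t ht).div ((hasDerivAt_id t).sub_const z) hne).congr_deriv ?_).hasDerivWithinAt
      simp only [id]
      field_simp
  rw [circleIntegral.integral_sub (circleIntegrable_div_sub hR hf' hz)
    (circleIntegrable_div_sub_pow hR hfint hz 2)] at hparts
  refine (hasDerivAt_cauchyTransform hR hfint hz).congr_deriv ?_
  rw [cauchyTransform, sub_eq_zero.1 hparts]

theorem cauchyTransform_id_mul (hR : 0 ≤ R) (hf : CircleIntegrable f c R)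
    (hz : z ∉ Metric.sphere c R) :
    cauchyTransform c R (fun t => t * f t) z =
      z * cauchyTransform c R f z + (2 * (Real.pi : ℂ) * Complex.I)⁻¹ * ∮ t in C(c, R), f t := by
  have hmul (a : ℂ → ℂ) (ha : Continuous a) : CircleIntegrable (fun t => a t * f t) c R :=
    hf.continuousOn_mul ha.continuousOn
  rw [← cauchyTransform_sub_mul hR hz f, ← cauchyTransform_const_mul z,
    ← cauchyTransform_add hR (hmul _ continuous_const) (hmul _ (by fun_prop)) hz]
  simp only [← add_mul, add_sub_cancel]

theorem sq_mul_cauchyTransform_deriv (hR : 0 ≤ R) (hz : z ∉ Metric.sphere c R)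
    (hf : ∀ t ∈ Metric.sphere c R, HasDerivAt f (f' t) t) (hf' : CircleIntegrable f' c R) :
    z ^ 2 * cauchyTransform c R f' z = cauchyTransform c R (fun t => t ^ 2 * f' t) z +
      (2 * (Real.pi : ℂ) * Complex.I)⁻¹ * ∮ t in C(c, R), f t := by
  have hmul : CircleIntegrable (fun t => t * f' t) c R :=
    hf'.continuousOn_mul continuous_id.continuousOn
  have hfint : CircleIntegrable f c R := ContinuousOn.circleIntegrable hR fun t ht =>
    (hf t ht).continuousAt.continuousWithinAt
  have hzero : ∮ t in C(c, R), f' t = 0 :=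
    circleIntegral.integral_eq_zero_of_hasDerivWithinAt hR fun t ht => (hf t ht).hasDerivWithinAt
  have hparts : (∮ t in C(c, R), f t) + ∮ t in C(c, R), t * f' t = 0 := by
    rw [← circleIntegral.integral_add hfint hmul]
    refine circleIntegral.integral_eq_zero_of_hasDerivWithinAt hR (f := fun t => t * f t)
      fun t ht => ?_
    exact (((hasDerivAt_id t).mul (hf t ht)).congr_deriv (by simp)).hasDerivWithinAt
  simp only [pow_two, mul_assoc]
  rw [cauchyTransform_id_mul hR hmul hz, cauchyTransform_id_mul hR hf' hz, hzero,
    eq_neg_of_add_eq_zero_left hparts]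
  ring

end CauchyTransform

/-! ### Functions of the second kind -/

/-- The Cauchy transform of `P ν / t ^ (N + 1)` over the unit circle; `G (N + 1)` and `GStar N` are
the cases `P = Φ (N + 1)` and `P = reciprocal Φ N`. -/
def weightedCauchy (ν : ℂ → ℂ) (N : ℕ) (P : ℂ[X]) : ℂ → ℂ :=
  cauchyTransform 0 1 fun t => P.eval t * (ν t / t ^ (N + 1))

section WeightedCauchy

variable {ν : ℂ → ℂ} {z : ℂ}

theorem G_succ (ν : ℂ → ℂ) (Φ : ℕ → ℂ[X]) (n : ℕ) :
    G ν Φ (n + 1) = weightedCauchy ν n (Φ (n + 1)) := by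
  funext z
  simp only [G, weightedCauchy, cauchyTransform, div_mul_eq_mul_div]

theorem GStar_eq (ν : ℂ → ℂ) (Φ : ℕ → ℂ[X]) (n : ℕ) :
    GStar ν Φ n = weightedCauchy ν n (reciprocal Φ n) := by
  funext z
  simp only [GStar, weightedCauchy, cauchyTransform, div_mul_eq_mul_div]

theorem circleIntegrable_eval_mul_div_pow (hν : CircleIntegrable ν 0 1) (N : ℕ) (P : ℂ[X]) :
    CircleIntegrable (fun t => P.eval t * (ν t / t ^ N)) 0 1 := by
  have hcont : ContinuousOn (fun t => P.eval t * (t ^ N)⁻¹) (Metric.sphere (0 : ℂ) |1|) := by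
    refine ContinuousOn.mul (Continuous.continuousOn (by fun_prop))
      (ContinuousOn.inv₀ (by fun_prop) fun t ht => ?_)
    exact pow_ne_zero N (ne_zero_of_mem_sphere (by simpa using ht))
  refine (congrArg (CircleIntegrable · 0 1) (funext fun t => ?_)).mp (hν.continuousOn_mul hcont)
  rw [Pi.mul_apply, mul_assoc, div_eq_inv_mul]

theorem differentiableOn_weightedCauchy (hν : CircleIntegrable ν 0 1) (N : ℕ) (P : ℂ[X]) :
    DifferentiableOn ℂ (weightedCauchy ν N P) (Metric.sphere 0 1)ᶜ := fun _ hz =>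
  (hasDerivAt_cauchyTransform zero_le_one (circleIntegrable_eval_mul_div_pow hν _ P)
    hz).differentiableAt.differentiableWithinAt

theorem integral_eval_mul_div_pow (ν : ℂ → ℂ) (N : ℕ) (P : ℂ[X]) :
    (2 * (Real.pi : ℂ) * Complex.I)⁻¹ * ∮ t in C(0, 1), P.eval t * (ν t / t ^ (N + 1)) =
      (2 * (Real.pi : ℂ))⁻¹ * pairing ν P (X ^ N) := by
  rw [mul_inv, mul_assoc, pairing, ← circleIntegral.integral_const_mul]
  refine congrArg _ (circleIntegral.integral_congr zero_le_one fun t ht => ?_)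
  have := ne_zero_of_mem_sphere ht
  have := Complex.I_ne_zero
  simp only [eval_pow, eval_X, map_pow, conj_eq_inv_of_mem_sphere ht, inv_pow,
    pow_succ]
  field_simp

theorem weightedCauchy_add (hν : CircleIntegrable ν 0 1) (hz : z ∉ Metric.sphere 0 1) (N : ℕ)
    (P Q : ℂ[X]) :
    weightedCauchy ν N (P + Q) z = weightedCauchy ν N P z + weightedCauchy ν N Q z := by
  simp only [weightedCauchy, eval_add, add_mul]
  exact cauchyTransform_add zero_le_one (circleIntegrable_eval_mul_div_pow hν _ P)
    (circleIntegrable_eval_mul_div_pow hν _ Q) hz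

theorem weightedCauchy_C_mul (ν : ℂ → ℂ) (N : ℕ) (c : ℂ) (P : ℂ[X]) (z : ℂ) :
    weightedCauchy ν N (C c * P) z = c * weightedCauchy ν N P z := by
  simp only [weightedCauchy, eval_mul, eval_C, mul_assoc]
  exact cauchyTransform_const_mul c _ z

theorem weightedCauchy_X_sub_C_mul (hz : z ∉ Metric.sphere 0 1) (N : ℕ) (P : ℂ[X]) :
    weightedCauchy ν N ((X - C z) * P) z = (2 * (Real.pi : ℂ))⁻¹ * pairing ν P (X ^ N) := by
  rw [← integral_eval_mul_div_pow, ← cauchyTransform_sub_mul zero_le_one hz]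
  simp only [weightedCauchy, eval_mul, eval_sub, eval_X, eval_C, mul_assoc]

theorem weightedCauchy_X_mul (hν : CircleIntegrable ν 0 1) (hz : z ∉ Metric.sphere 0 1) (N : ℕ)
    (P : ℂ[X]) :
    weightedCauchy ν N (X * P) z =
      z * weightedCauchy ν N P z + (2 * (Real.pi : ℂ))⁻¹ * pairing ν P (X ^ N) := by
  rw [← weightedCauchy_X_sub_C_mul hz, ← weightedCauchy_C_mul, ← weightedCauchy_add hν hz]
  congr 1
  ring

theorem weightedCauchy_mul (hν : CircleIntegrable ν 0 1) (hz : z ∉ Metric.sphere 0 1) (N : ℕ)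
    (Q P : ℂ[X]) :
    weightedCauchy ν N (Q * P) z = Q.eval z * weightedCauchy ν N P z +
      (2 * (Real.pi : ℂ))⁻¹ * pairing ν (Q /ₘ (X - C z) * P) (X ^ N) := by
  conv_lhs => rw [← modByMonic_add_div Q (X - C z), modByMonic_X_sub_C_eq_C_eval, add_mul,
    weightedCauchy_add hν hz, weightedCauchy_C_mul, mul_assoc, weightedCauchy_X_sub_C_mul hz]

theorem hasDerivAt_div_pow {w : ℂ[X]} {t : ℂ} (hν : HasDerivAt ν (w.eval t / t ^ 2 * ν t) t)
    (ht : t ≠ 0) (N : ℕ) :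
    HasDerivAt (fun t => ν t / t ^ N)
      ((w - C (N : ℂ) * X).eval t / t ^ 2 * (ν t / t ^ N)) t := by
  refine (hν.div (hasDerivAt_pow N t) (pow_ne_zero _ ht)).congr_deriv ?_
  simp only [eval_sub, eval_mul, eval_X, eval_C]
  rcases N with _ | N
  · push_cast
    field_simp
    ring
  · rw [Nat.add_sub_cancel]
    field_simp
    ring

section Pearson

variable {w : ℂ[X]} (hν : ∀ t ∈ Metric.sphere (0 : ℂ) 1, HasDerivAt ν (w.eval t / t ^ 2 * ν t) t)
include hν

theorem circleIntegrable_of_hasDerivAt : CircleIntegrable ν 0 1 :=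
  ContinuousOn.circleIntegrable zero_le_one fun t ht =>
    (hν t ht).continuousAt.continuousWithinAt

theorem hasDerivAt_eval_mul_div_pow (N : ℕ) (P : ℂ[X]) {t : ℂ} (ht : t ∈ Metric.sphere 0 1) :
    HasDerivAt (fun t => P.eval t * (ν t / t ^ N))
      ((X ^ 2 * derivative P + (w - C (N : ℂ) * X) * P).eval t * (ν t / t ^ (N + 2))) t := by
  have h0 := ne_zero_of_mem_sphere ht
  refine ((P.hasDerivAt t).mul (hasDerivAt_div_pow (hν t ht) h0 N)).congr_deriv ?_
  simp only [eval_add, eval_mul, eval_pow, eval_X]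
  field_simp
  ring

theorem pairing_pearson_eq_zero (N : ℕ) (P : ℂ[X]) :
    pairing ν (X ^ 2 * derivative P + (w - C (N : ℂ) * X) * P) (X ^ (N + 1)) = 0 := by
  have h := integral_eval_mul_div_pow ν (N + 1) (X ^ 2 * derivative P + (w - C (N : ℂ) * X) * P)
  rw [circleIntegral.integral_eq_zero_of_hasDerivWithinAt zero_le_one fun t ht =>
    (hasDerivAt_eval_mul_div_pow hν N P ht).hasDerivWithinAt, mul_zero] at h
  exact (mul_eq_zero.1 h.symm).resolve_left (inv_ne_zero two_pi_ne_zero)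

theorem hasDerivAt_weightedCauchy (hz : z ∉ Metric.sphere 0 1) (N : ℕ) (P : ℂ[X]) :
    ∃ v, HasDerivAt (weightedCauchy ν N P) v z ∧
      z ^ 2 * v =
        weightedCauchy ν N (X ^ 2 * derivative P + (w - C ((N + 1 : ℕ) : ℂ) * X) * P) z +
          (2 * (Real.pi : ℂ))⁻¹ * pairing ν P (X ^ N) := by
  have hint := circleIntegrable_eval_mul_div_pow (circleIntegrable_of_hasDerivAt hν)
    (N + 3) (X ^ 2 * derivative P + (w - C ((N + 1 : ℕ) : ℂ) * X) * P)
  have hderiv (t : ℂ) (ht : t ∈ Metric.sphere 0 1) := hasDerivAt_eval_mul_div_pow hν (N + 1) P ht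
  refine ⟨_, hasDerivAt_cauchyTransform_of_hasDerivAt zero_le_one hz hderiv hint, ?_⟩
  rw [sq_mul_cauchyTransform_deriv zero_le_one hz hderiv hint, integral_eval_mul_div_pow]
  refine congrArg (· + _) (cauchyTransform_congr zero_le_one (fun t ht => ?_) z)
  have := ne_zero_of_mem_sphere ht
  field_simp
  ring

end Pearson

end WeightedCauchy

namespace IsMonicOPUC

variable {ν : ℂ → ℂ} {Φ : ℕ → ℂ[X]} {κ : ℕ → ℝ} {z : ℂ}

theorem reciprocal_mul_G_sub (hν : CircleIntegrable ν 0 1) (hΦ : IsMonicOPUC ν Φ κ)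
    (hz : z ∉ Metric.sphere 0 1) (n : ℕ) :
    (reciprocal Φ n).eval z * G ν Φ (n + 1) z - (Φ (n + 1)).eval z * GStar ν Φ n z =
      (bCoeff κ n)⁻¹ := by
  have hRdeg : (reciprocal Φ n /ₘ (X - C z)).natDegree ≤ n := by
    rw [natDegree_divByMonic _ (monic_X_sub_C z)]
    exact (Nat.sub_le _ _).trans (hΦ.natDegree_reciprocal_le n)
  have hΦdeg : (Φ (n + 1) /ₘ (X - C z)).natDegree = n := by
    rw [natDegree_divByMonic _ (monic_X_sub_C z), natDegree_X_sub_C, hΦ.natDegree_eq,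
      Nat.add_sub_cancel]
  have hlead : (Φ (n + 1) /ₘ (X - C z)).coeff n = 1 := by
    have hlc : (Φ (n + 1) /ₘ (X - C z)).leadingCoeff = 1 := by
      refine (leadingCoeff_divByMonic_of_monic (monic_X_sub_C z) ?_).trans (hΦ.monic _)
      rw [degree_X_sub_C, degree_eq_natDegree (hΦ.monic _).ne_zero, hΦ.natDegree_eq]
      exact_mod_cast Nat.le_add_left 1 n
    rwa [leadingCoeff, hΦdeg] at hlc
  have hG : pairing ν (reciprocal Φ n /ₘ (X - C z) * Φ (n + 1)) (X ^ n) = 0 := by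
    rw [pairing_mul_X_pow hRdeg]
    exact hΦ.pairing_right_eq_zero hν (Nat.lt_succ_of_le (natDegree_conjReflect_le hRdeg))
  have hGStar : pairing ν (Φ (n + 1) /ₘ (X - C z) * reciprocal Φ n) (X ^ n) =
      ((κ n : ℂ) ^ 2)⁻¹ := by
    rw [pairing_mul_X_pow hΦdeg.le]
    refine (pairing_conjReflect (hΦ.natDegree_eq n).le hΦdeg.le).trans ?_
    rw [hΦ.pairing_left hν hΦdeg.le, hlead, one_mul]
  have h := weightedCauchy_mul hν hz n (reciprocal Φ n) (Φ (n + 1))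
  rw [mul_comm (reciprocal Φ n) (Φ (n + 1)), weightedCauchy_mul hν hz, hG, hGStar, ← GStar_eq,
    ← G_succ, ← mul_inv] at h
  rw [bCoeff]
  linear_combination -h

theorem det_Y_succ (hν : CircleIntegrable ν 0 1) (hΦ : IsMonicOPUC ν Φ κ)
    (hz : z ∉ Metric.sphere 0 1) (n : ℕ) : (Y ν Φ κ (n + 1) z).det = 1 := by
  rw [Y, Matrix.det_fin_two_of, Nat.add_sub_cancel]
  linear_combination bCoeff κ n * hΦ.reciprocal_mul_G_sub hν hz n +
    mul_inv_cancel₀ (hΦ.bCoeff_ne_zero n)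

end IsMonicOPUC

/-! ### The modified Bessel weight -/

section Weight

theorem weight_inv (ℓ : ℝ) (z : ℂ) : weight ℓ z⁻¹ = weight ℓ z := by
  rw [weight, weight, inv_inv, add_comm]

theorem hasDerivAt_weight (ℓ : ℝ) {z : ℂ} (hz : z ≠ 0) :
    HasDerivAt (weight ℓ) ((C (ℓ / 2 : ℂ) * (X ^ 2 - 1)).eval z / z ^ 2 * weight ℓ z) z := by
  refine ((((hasDerivAt_id z).add (hasDerivAt_inv hz)).const_mul (ℓ : ℂ)).div_const
    2).cexp.congr_deriv ?_
  simp only [weight, Pi.add_apply, id, eval_mul, eval_sub, eval_pow, eval_C, eval_X, eval_one]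
  field_simp
  ring

theorem circleIntegrable_weight (ℓ : ℝ) : CircleIntegrable (weight ℓ) 0 1 :=
  circleIntegrable_of_hasDerivAt fun _ ht => hasDerivAt_weight ℓ (ne_zero_of_mem_sphere ht)

theorem pairing_weight_X_mul_derivative (ℓ : ℝ) (P : ℂ[X]) (j : ℕ) :
    pairing (weight ℓ) (X * derivative P) (X ^ j) = j * pairing (weight ℓ) P (X ^ j) +
      ℓ / 2 * (pairing (weight ℓ) P (X ^ (j + 1)) - pairing (weight ℓ) (X * P) (X ^ j)) := by
  have hν := circleIntegrable_weight ℓ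
  have hpoly : X ^ 2 * derivative P + (C (ℓ / 2 : ℂ) * (X ^ 2 - 1) - C (j : ℂ) * X) * P =
      X * (X * derivative P) + (ℓ / 2 : ℂ) • (X * (X * P) - P) - (j : ℂ) • (X * P) := by
    simp only [smul_eq_C_mul]
    ring
  have h := pairing_pearson_eq_zero (fun _ ht => hasDerivAt_weight ℓ (ne_zero_of_mem_sphere ht)) j P
  rw [hpoly, pow_succ', ← pairingForm_apply hν] at h
  simp only [map_add, map_sub, map_smul, LinearMap.add_apply, LinearMap.sub_apply,
    LinearMap.smul_apply, pairingForm_apply, smul_eq_mul, pairing_X_mul_X_mul] at h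
  rw [pow_succ']
  linear_combination h

end Weight

namespace IsMonicOPUC

variable {ℓ : ℝ} {Φ : ℕ → ℂ[X]} {κ : ℕ → ℝ}

theorem conj_verblunsky_weight (hΦ : IsMonicOPUC (weight ℓ) Φ κ) (k : ℤ) :
    conj (verblunsky Φ k) = verblunsky Φ k :=
  hΦ.conj_verblunsky (circleIntegrable_weight ℓ) (fun t _ => weight_inv ℓ t) k

theorem X_mul_eq (hΦ : IsMonicOPUC (weight ℓ) Φ κ) (n : ℕ) :
    X * Φ n = Φ (n + 1) + C (verblunsky Φ n) * reciprocal Φ n := by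
  have h := hΦ.succ_eq (circleIntegrable_weight ℓ) n
  rw [hΦ.conj_verblunsky_weight] at h
  rw [h, sub_add_cancel]

theorem inv_kappa_sq_succ_weight (hΦ : IsMonicOPUC (weight ℓ) Φ κ) (n : ℕ) :
    ((κ (n + 1) : ℂ) ^ 2)⁻¹ = (1 - verblunsky Φ n ^ 2) * ((κ n : ℂ) ^ 2)⁻¹ := by
  rw [hΦ.inv_kappa_sq_succ (circleIntegrable_weight ℓ), hΦ.conj_verblunsky_weight, ← sq]

theorem bCoeff_mul_inv_bCoeff_succ_weight (hΦ : IsMonicOPUC (weight ℓ) Φ κ) (n : ℕ) :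
    bCoeff κ n * (bCoeff κ (n + 1))⁻¹ = 1 - verblunsky Φ n ^ 2 := by
  rw [hΦ.bCoeff_mul_inv_bCoeff_succ (circleIntegrable_weight ℓ), hΦ.conj_verblunsky_weight, ← sq]

theorem pairing_X_mul_X_pow (hΦ : IsMonicOPUC (weight ℓ) Φ κ) {n j : ℕ} (hj : j ≤ n) :
    pairing (weight ℓ) (X * Φ n) (X ^ j) =
      verblunsky Φ n * pairing (weight ℓ) (reciprocal Φ n) (X ^ j) := by
  have hν := circleIntegrable_weight ℓ
  have horth := hΦ.pairing_right_eq_zero hν (n := n + 1) (Q := X ^ j)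
    ((natDegree_X_pow_le j).trans_lt (Nat.lt_succ_of_le hj))
  rw [← pairingForm_apply hν, hΦ.X_mul_eq, ← smul_eq_C_mul, map_add, map_smul,
    LinearMap.add_apply, LinearMap.smul_apply, pairingForm_apply, pairingForm_apply, horth,
    zero_add, smul_eq_mul]

theorem X_mul_derivative_succ (hΦ : IsMonicOPUC (weight ℓ) Φ κ) (n : ℕ) :
    X * derivative (Φ (n + 1)) = C ((n : ℂ) + 1) * Φ (n + 1) +
      C (ℓ / 2 * (1 - verblunsky Φ n ^ 2)) *
        (Φ n - C (verblunsky Φ (n + 1)) * reciprocal Φ n) := by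
  have hν := circleIntegrable_weight ℓ
  set R := X * derivative (Φ (n + 1)) - C ((n : ℂ) + 1) * Φ (n + 1) with hR
  set Q := Φ n - C (verblunsky Φ (n + 1)) * reciprocal Φ n with hQ
  have hdeg : (R - C (ℓ / 2 * (1 - verblunsky Φ n ^ 2)) * Q).natDegree ≤ n :=
    (natDegree_sub_le_of_le
      (natDegree_X_mul_derivative_sub_le (by simpa using (hΦ.natDegree_eq (n + 1)).le))
      ((natDegree_C_mul_le _ _).trans (natDegree_sub_le_of_le (hΦ.natDegree_eq n).le
        ((natDegree_C_mul_le _ _).trans (hΦ.natDegree_reciprocal_le n))))).trans_eq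
      ((congrArg _ (max_self n)).trans (max_self n))
  have horth (j : ℕ) (hj : j < n + 1) :
      pairing (weight ℓ) (R - C (ℓ / 2 * (1 - verblunsky Φ n ^ 2)) * Q) (X ^ j) = 0 := by
    have hXj : (X ^ j : ℂ[X]).natDegree ≤ n :=
      (natDegree_X_pow_le j).trans (Nat.lt_succ_iff.1 hj)
    have hXj' : (X ^ (j + 1) : ℂ[X]).natDegree ≤ n + 1 := (natDegree_X_pow_le _).trans hj
    simp only [hR, hQ, ← smul_eq_C_mul]
    rw [← pairingForm_apply hν]
    simp only [map_sub, map_smul, LinearMap.sub_apply, LinearMap.smul_apply, pairingForm_apply,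
      smul_eq_mul]
    rw [pairing_weight_X_mul_derivative, hΦ.pairing_right_eq_zero hν (Nat.lt_succ_of_le hXj),
      hΦ.pairing_right hν hXj', hΦ.pairing_X_mul_X_pow hj.le, hΦ.pairing_right hν hXj,
      hΦ.pairing_reciprocal hν hXj, hΦ.pairing_reciprocal hν (hXj.trans n.le_succ),
      hΦ.inv_kappa_sq_succ_weight]
    simp only [coeff_X_pow, Nat.add_right_cancel_iff, Nat.cast_succ]
    ring
  have h := hΦ.eq_zero_of_pairing_X_pow_eq_zero hν
    ((degree_le_of_natDegree_le hdeg).trans_lt (Nat.cast_lt.2 n.lt_succ_self)) horth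
  linear_combination h

theorem discrete_painleve (hΦ : IsMonicOPUC (weight ℓ) Φ κ) (n : ℕ) :
    (n + 1) * verblunsky Φ n + ℓ / 2 * (1 - verblunsky Φ n ^ 2) *
      (verblunsky Φ (n - 1) + verblunsky Φ (n + 1)) = 0 := by
  have h := congrArg (eval 0) (hΦ.X_mul_derivative_succ n)
  have hα (m : ℕ) : (Φ m).eval 0 = -verblunsky Φ (m - 1) := by
    rw [← hΦ.conj_verblunsky_weight, verblunsky_natCast_sub_one, map_neg, Complex.conj_conj,
      neg_neg]
  simp only [eval_mul, eval_add, eval_sub, eval_X, eval_C, hα, hΦ.eval_zero_reciprocal,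
    Nat.cast_succ, add_sub_cancel_right] at h
  linear_combination h

theorem one_sub_sq_mul_reciprocal (hΦ : IsMonicOPUC (weight ℓ) Φ κ) (n : ℕ) :
    C (1 - verblunsky Φ n ^ 2) * reciprocal Φ n =
      reciprocal Φ (n + 1) + C (verblunsky Φ n) * Φ (n + 1) := by
  rw [hΦ.reciprocal_succ_eq (circleIntegrable_weight ℓ), hΦ.X_mul_eq, C_sub, C_1, C_pow]
  ring

theorem one_sub_sq_mul_X_mul (hΦ : IsMonicOPUC (weight ℓ) Φ κ) (n : ℕ) :
    C (1 - verblunsky Φ n ^ 2) * (X * Φ n) =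
      Φ (n + 1) + C (verblunsky Φ n) * reciprocal Φ (n + 1) := by
  rw [hΦ.reciprocal_succ_eq (circleIntegrable_weight ℓ), C_sub, C_1, C_pow]
  linear_combination hΦ.X_mul_eq n

theorem X_mul_derivative_reciprocal (hΦ : IsMonicOPUC (weight ℓ) Φ κ) (n : ℕ) :
    X * derivative (reciprocal Φ n) = C (ℓ / 2 : ℂ) *
      (C (verblunsky Φ n) * (Φ n + C (verblunsky Φ (n - 1)) * reciprocal Φ n) -
        X * (reciprocal Φ n + C (verblunsky Φ (n - 1)) * Φ n)) := by
  rcases n with _ | n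
  · have h1 : reciprocal Φ 0 = 1 := by
      rw [reciprocal, hΦ.eq_one, reflect_one, pow_zero, Polynomial.map_one]
    have h2 : verblunsky Φ ((0 : ℕ) - 1) = -1 := by
      rw [verblunsky_natCast_sub_one, hΦ.eq_one, eval_one, map_one]
    rw [h1, h2, hΦ.eq_one, C_neg, C_1, derivative_one]
    ring
  · have h := X_mul_derivative_conjReflect (hΦ.natDegree_eq (n + 1)).le
    rw [hΦ.X_mul_derivative_succ, Nat.cast_succ, sub_add_cancel_left, ← neg_mul, ← C_neg,
      conjReflect_C_mul, conjReflect_sub, conjReflect_C_mul, hΦ.conj_verblunsky_weight,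
      conjReflect_succ (hΦ.natDegree_eq n).le, conjReflect_succ (hΦ.natDegree_reciprocal_le n)] at h
    change X * derivative (reciprocal Φ (n + 1)) = _ * (X * reciprocal Φ n -
      _ * (X * conjReflect n (conjReflect n (Φ n)))) at h
    rw [conjReflect_conjReflect] at h
    simp only [map_neg, map_mul, map_sub, map_div₀, map_pow, hΦ.conj_verblunsky_weight,
      Complex.conj_ofReal, map_one, map_ofNat] at h
    rw [h, Nat.cast_succ, add_sub_cancel_right]
    have h1 := hΦ.one_sub_sq_mul_reciprocal n
    have h2 := hΦ.one_sub_sq_mul_X_mul n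
    simp only [C_sub, C_1, C_pow] at h1 h2
    linear_combination C (ℓ / 2 : ℂ) * (C (verblunsky Φ (n + 1)) * h2 - X * h1)

end IsMonicOPUC

/-! ### Second-order equations of a `2 × 2` system -/

/-- `(f, g)` is a holomorphic solution on `U` of the system `z² v' = L(z) v` with polynomial
coefficient matrix `L`, in the form that makes sense at the singular point `z = 0` as well. -/
structure IsSystemSolution (L : Matrix (Fin 2) (Fin 2) ℂ[X]) (U : Set ℂ) (f g : ℂ → ℂ) :
    Prop where
  diff_left : DifferentiableOn ℂ f U
  diff_right : DifferentiableOn ℂ g U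
  sq_mul_deriv_left : ∀ z ∈ U,
    z ^ 2 * deriv f z = (L 0 0).eval z * f z + (L 0 1).eval z * g z
  sq_mul_deriv_right : ∀ z ∈ U,
    z ^ 2 * deriv g z = (L 1 0).eval z * f z + (L 1 1).eval z * g z

namespace IsSystemSolution

variable {L : Matrix (Fin 2) (Fin 2) ℂ[X]} {T : ℂ[X]} {U : Set ℂ} {f g : ℂ → ℂ} {z : ℂ}

theorem swap (h : IsSystemSolution L U f g) :
    IsSystemSolution !![L 1 1, L 1 0; L 0 1, L 0 0] U g f where
  diff_left := h.diff_right
  diff_right := h.diff_left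
  sq_mul_deriv_left z hz := (h.sq_mul_deriv_right z hz).trans (add_comm _ _)
  sq_mul_deriv_right z hz := (h.sq_mul_deriv_left z hz).trans (add_comm _ _)

theorem offDiag_mul_deriv_right (h : IsSystemSolution L U f g) (hU : IsOpen U)
    (hdet : L.det = X ^ 2 * T) (hz : z ∈ U) :
    (L 0 1).eval z * deriv g z = (L 1 1).eval z * deriv f z - T.eval z * f z := by
  have hUz : ∀ᶠ w in 𝓝 z, w ∈ U := hU.mem_nhds hz
  have hf' := ((h.diff_left.deriv hU).differentiableAt hUz).continuousAt
  have hg' := ((h.diff_right.deriv hU).differentiableAt hUz).continuousAt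
  have hf := (h.diff_left.differentiableAt hUz).continuousAt
  have hne : ∀ᶠ w in 𝓝[≠] z, w ≠ 0 := by
    rcases eq_or_ne z 0 with rfl | h0
    · exact self_mem_nhdsWithin
    · exact nhdsWithin_le_nhds (isOpen_ne.mem_nhds h0)
  have hpunctured : (fun w => (L 0 1).eval w * deriv g w) =ᶠ[𝓝[≠] z]
      fun w => (L 1 1).eval w * deriv f w - T.eval w * f w := by
    filter_upwards [hne, nhdsWithin_le_nhds hUz] with w hw hwU
    have hdetw := congrArg (eval w) hdet
    rw [Matrix.det_fin_two, eval_sub, eval_mul, eval_mul, eval_mul, eval_pow, eval_X] at hdetw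
    refine mul_left_cancel₀ (pow_ne_zero 2 hw) ?_
    linear_combination (L 0 1).eval w * h.sq_mul_deriv_right w hwU -
      (L 1 1).eval w * h.sq_mul_deriv_left w hwU - f w * hdetw
  exact (((L 0 1).continuous.continuousAt.mul hg').eventuallyEq_nhds_iff_eventuallyEq_nhdsNE
    (((L 1 1).continuous.continuousAt.mul hf').sub
      (T.continuous.continuousAt.mul hf))).1 hpunctured |>.eq_of_nhds

theorem sq_mul_deriv_deriv_left (h : IsSystemSolution L U f g) (hU : IsOpen U)
    (hdet : L.det = X ^ 2 * T) (hz : z ∈ U) :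
    z ^ 2 * deriv (deriv f) z + (2 * z - L.trace.eval z) * deriv f z +
        (T.eval z - (derivative (L 0 0)).eval z) * f z =
      (derivative (L 0 1)).eval z * g z := by
  have hUz : ∀ᶠ w in 𝓝 z, w ∈ U := hU.mem_nhds hz
  have hf := (h.diff_left.differentiableAt hUz).hasDerivAt
  have hg := (h.diff_right.differentiableAt hUz).hasDerivAt
  have hf' := ((h.diff_left.deriv hU).differentiableAt hUz).hasDerivAt
  have hlhs := (hasDerivAt_pow 2 z).mul hf'
  have hrhs := (((L 0 0).hasDerivAt z).mul hf).add (((L 0 1).hasDerivAt z).mul hg)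
  have heq := hlhs.unique (hrhs.congr_of_eventuallyEq (hUz.mono h.sq_mul_deriv_left))
  rw [Matrix.trace_fin_two, eval_add]
  simp only [Nat.cast_ofNat, Nat.add_one_sub_one, pow_one] at heq
  linear_combination heq + h.offDiag_mul_deriv_right hU hdet hz

theorem sq_mul_deriv_deriv_right (h : IsSystemSolution L U f g) (hU : IsOpen U)
    (hdet : L.det = X ^ 2 * T) (hz : z ∈ U) :
    z ^ 2 * deriv (deriv g) z + (2 * z - L.trace.eval z) * deriv g z +
        (T.eval z - (derivative (L 1 1)).eval z) * g z =
      (derivative (L 1 0)).eval z * f z := by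
  have hdet' : Matrix.det !![L 1 1, L 1 0; L 0 1, L 0 0] = X ^ 2 * T := by
    rw [← hdet, Matrix.det_fin_two_of, Matrix.det_fin_two]
    ring
  have htrace : Matrix.trace !![L 1 1, L 1 0; L 0 1, L 0 0] = L.trace := by
    rw [Matrix.trace_fin_two_of, Matrix.trace_fin_two, add_comm]
  rw [← htrace]
  exact h.swap.sq_mul_deriv_deriv_left hU hdet' hz

end IsSystemSolution

/-! ### The Lax pair of the modified Bessel weight -/

/-- The coefficient matrix `L` of the system `z² v' = L(z) v` solved by
`(Φ (n + 1), reciprocal Φ n)`. -/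
def laxMatrix (ℓ : ℝ) (Φ : ℕ → ℂ[X]) (n : ℕ) : Matrix (Fin 2) (Fin 2) ℂ[X] :=
  !![C ((n : ℂ) + 1) * X + C (ℓ / 2 * (1 - verblunsky Φ n ^ 2)),
      C (ℓ / 2 * (1 - verblunsky Φ n ^ 2)) *
        (C (verblunsky Φ n) - C (verblunsky Φ (n + 1)) * X);
    C (ℓ / 2 : ℂ) * (C (verblunsky Φ n) - C (verblunsky Φ (n - 1)) * X),
      C (ℓ / 2 : ℂ) * (C (verblunsky Φ n ^ 2) - X ^ 2)]

/-- `z²` times the logarithmic derivative of `ν(z) / z ^ (n + 1)`, where `ν` is the modified Bessel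
weight. -/
def weightLogDeriv (ℓ : ℝ) (n : ℕ) : ℂ[X] :=
  C (ℓ / 2 : ℂ) * (X ^ 2 - 1) - C ((n + 1 : ℕ) : ℂ) * X

/-- The coefficient matrix of the system `z² v' = L(z) v` solved by the functions of the second kind
`(G (n + 1), GStar n)`. As the trace of `laxMatrix` is `-weightLogDeriv`, this matrix is
`laxMatrix + weightLogDeriv • 1`. -/
def dualLaxMatrix (ℓ : ℝ) (Φ : ℕ → ℂ[X]) (n : ℕ) : Matrix (Fin 2) (Fin 2) ℂ[X] :=
  !![-laxMatrix ℓ Φ n 1 1, laxMatrix ℓ Φ n 0 1; laxMatrix ℓ Φ n 1 0, -laxMatrix ℓ Φ n 0 0]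

/-- The quotient of `(laxMatrix ℓ Φ n).det` by `X ^ 2`; its constant term is `-(ℓ² / 4 + K)`, where
`K = ℓ² / 4 * ((1 - α_n²) α_{n+1} α_{n-1} - α_n²)` is the constant of the second-order equations. -/
def laxDetQuotient (ℓ : ℝ) (Φ : ℕ → ℂ[X]) (n : ℕ) : ℂ[X] :=
  -(C (ℓ * (n + 1) / 2 : ℂ) * X + C (ℓ ^ 2 / 4 + ℓ ^ 2 / 4 *
    ((1 - verblunsky Φ n ^ 2) * verblunsky Φ (n + 1) * verblunsky Φ (n - 1) - verblunsky Φ n ^ 2)))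

theorem trace_laxMatrix (ℓ : ℝ) (Φ : ℕ → ℂ[X]) (n : ℕ) :
    (laxMatrix ℓ Φ n).trace = -weightLogDeriv ℓ n := by
  rw [laxMatrix, Matrix.trace_fin_two_of, weightLogDeriv]
  refine Polynomial.funext fun z => ?_
  simp only [eval_add, eval_mul, eval_sub, eval_neg, eval_pow, eval_C, eval_X, eval_one,
    Nat.cast_succ]
  ring

theorem trace_dualLaxMatrix (ℓ : ℝ) (Φ : ℕ → ℂ[X]) (n : ℕ) :
    (dualLaxMatrix ℓ Φ n).trace = weightLogDeriv ℓ n := by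
  rw [← neg_neg (weightLogDeriv ℓ n), ← trace_laxMatrix ℓ Φ, dualLaxMatrix, Matrix.trace_fin_two_of,
    Matrix.trace_fin_two]
  ring

theorem det_dualLaxMatrix (ℓ : ℝ) (Φ : ℕ → ℂ[X]) (n : ℕ) :
    (dualLaxMatrix ℓ Φ n).det = (laxMatrix ℓ Φ n).det := by
  rw [dualLaxMatrix, Matrix.det_fin_two_of, Matrix.det_fin_two]
  ring

namespace IsMonicOPUC

variable {ℓ : ℝ} {Φ : ℕ → ℂ[X]} {κ : ℕ → ℝ}

theorem det_laxMatrix (hΦ : IsMonicOPUC (weight ℓ) Φ κ) (n : ℕ) :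
    (laxMatrix ℓ Φ n).det = X ^ 2 * laxDetQuotient ℓ Φ n := by
  rw [laxMatrix, Matrix.det_fin_two_of, laxDetQuotient]
  refine Polynomial.funext fun z => ?_
  simp only [eval_add, eval_mul, eval_sub, eval_neg, eval_pow, eval_C, eval_X]
  linear_combination ℓ / 2 * verblunsky Φ n * z * hΦ.discrete_painleve n

theorem X_sq_mul_derivative (hΦ : IsMonicOPUC (weight ℓ) Φ κ) (n : ℕ) :
    X ^ 2 * derivative (Φ (n + 1)) =
      laxMatrix ℓ Φ n 0 0 * Φ (n + 1) + laxMatrix ℓ Φ n 0 1 * reciprocal Φ n := by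
  simp only [laxMatrix, Matrix.of_apply, Matrix.cons_val]
  linear_combination X * hΦ.X_mul_derivative_succ n +
    C (ℓ / 2 * (1 - verblunsky Φ n ^ 2)) * hΦ.X_mul_eq n

theorem X_sq_mul_derivative_reciprocal (hΦ : IsMonicOPUC (weight ℓ) Φ κ) (n : ℕ) :
    X ^ 2 * derivative (reciprocal Φ n) =
      laxMatrix ℓ Φ n 1 0 * Φ (n + 1) + laxMatrix ℓ Φ n 1 1 * reciprocal Φ n := by
  simp only [laxMatrix, Matrix.of_apply, Matrix.cons_val, C_pow]
  linear_combination X * hΦ.X_mul_derivative_reciprocal n +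
    C (ℓ / 2 : ℂ) * (C (verblunsky Φ n) - X * C (verblunsky Φ (n - 1))) * hΦ.X_mul_eq n

theorem isSystemSolution_eval (hΦ : IsMonicOPUC (weight ℓ) Φ κ) (n : ℕ) :
    IsSystemSolution (laxMatrix ℓ Φ n) Set.univ (fun z => (Φ (n + 1)).eval z)
      (fun z => (reciprocal Φ n).eval z) where
  diff_left := (Φ (n + 1)).differentiable.differentiableOn
  diff_right := (reciprocal Φ n).differentiable.differentiableOn
  sq_mul_deriv_left z _ := by
    simpa only [Polynomial.deriv, eval_mul, eval_add, eval_pow, eval_X] using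
      congrArg (eval z) (hΦ.X_sq_mul_derivative n)
  sq_mul_deriv_right z _ := by
    simpa only [Polynomial.deriv, eval_mul, eval_add, eval_pow, eval_X] using
      congrArg (eval z) (hΦ.X_sq_mul_derivative_reciprocal n)

theorem pairing_X_mul_succ_X_pow (hΦ : IsMonicOPUC (weight ℓ) Φ κ) (n : ℕ) :
    pairing (weight ℓ) (X * Φ (n + 1)) (X ^ n) = (1 - verblunsky Φ n ^ 2) *
      verblunsky Φ (n + 1) * pairing (weight ℓ) (reciprocal Φ n) (X ^ n) := by
  have hν := circleIntegrable_weight ℓ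
  have hX : (X ^ n : ℂ[X]).natDegree ≤ n := natDegree_X_pow_le n
  rw [hΦ.pairing_X_mul_X_pow n.le_succ, hΦ.pairing_reciprocal hν (hX.trans n.le_succ),
    hΦ.pairing_reciprocal hν hX, hΦ.inv_kappa_sq_succ_weight, Nat.cast_succ]
  ring

theorem weightedCauchy_derivative_succ (hΦ : IsMonicOPUC (weight ℓ) Φ κ) {z : ℂ}
    (hz : z ∉ Metric.sphere 0 1) (n : ℕ) :
    weightedCauchy (weight ℓ) n
        (X ^ 2 * derivative (Φ (n + 1)) + weightLogDeriv ℓ n * Φ (n + 1)) z =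
      (dualLaxMatrix ℓ Φ n 0 0).eval z * G (weight ℓ) Φ (n + 1) z +
        (dualLaxMatrix ℓ Φ n 0 1).eval z * GStar (weight ℓ) Φ n z := by
  have hν := circleIntegrable_weight ℓ
  have horth := hΦ.pairing_right_eq_zero hν
    ((natDegree_X_pow_le (R := ℂ) n).trans_lt n.lt_succ_self)
  have hpoly : X ^ 2 * derivative (Φ (n + 1)) + weightLogDeriv ℓ n * Φ (n + 1) =
      C (ℓ / 2 : ℂ) * (X * (X * Φ (n + 1))) +
        C (-(ℓ / 2 * verblunsky Φ n ^ 2)) * Φ (n + 1) +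
        C (ℓ / 2 * (1 - verblunsky Φ n ^ 2) * verblunsky Φ n) * reciprocal Φ n +
        C (-(ℓ / 2 * (1 - verblunsky Φ n ^ 2) * verblunsky Φ (n + 1))) *
          (X * reciprocal Φ n) := by
    rw [hΦ.X_sq_mul_derivative]
    simp only [laxMatrix, weightLogDeriv, Matrix.of_apply, Matrix.cons_val, Nat.cast_succ, C_neg,
      C_mul, C_sub, C_add, C_1, C_pow]
    ring
  rw [hpoly, G_succ, GStar_eq]
  simp only [weightedCauchy_add hν hz, weightedCauchy_C_mul, weightedCauchy_X_mul hν hz, horth,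
    hΦ.pairing_X_mul_succ_X_pow, dualLaxMatrix, laxMatrix, Matrix.of_apply, Matrix.cons_val,
    eval_neg, eval_mul, eval_sub, eval_pow, eval_C, eval_X]
  ring

theorem weightedCauchy_derivative_reciprocal (hΦ : IsMonicOPUC (weight ℓ) Φ κ) {z : ℂ}
    (hz : z ∉ Metric.sphere 0 1) (n : ℕ) :
    weightedCauchy (weight ℓ) n
        (X ^ 2 * derivative (reciprocal Φ n) + weightLogDeriv ℓ n * reciprocal Φ n) z +
        (2 * (Real.pi : ℂ))⁻¹ * pairing (weight ℓ) (reciprocal Φ n) (X ^ n) =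
      (dualLaxMatrix ℓ Φ n 1 0).eval z * G (weight ℓ) Φ (n + 1) z +
        (dualLaxMatrix ℓ Φ n 1 1).eval z * GStar (weight ℓ) Φ n z := by
  have hν := circleIntegrable_weight ℓ
  have horth := hΦ.pairing_right_eq_zero hν
    ((natDegree_X_pow_le (R := ℂ) n).trans_lt n.lt_succ_self)
  have hpairing : n * pairing (weight ℓ) (reciprocal Φ n) (X ^ n) = 0 := by
    rw [hΦ.pairing_reciprocal hν (natDegree_X_pow_le n), coeff_X_pow]
    rcases eq_or_ne n 0 with rfl | hn
    · rw [Nat.cast_zero, zero_mul]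
    · rw [if_neg hn.symm, map_zero, zero_mul, mul_zero]
  have hpoly : X ^ 2 * derivative (reciprocal Φ n) + weightLogDeriv ℓ n * reciprocal Φ n =
      C (ℓ / 2 * verblunsky Φ n) * Φ (n + 1) +
        C (-(ℓ / 2 * verblunsky Φ (n - 1))) * (X * Φ (n + 1)) +
        C (-((n : ℂ) + 1)) * (X * reciprocal Φ n) +
        C (-(ℓ / 2 * (1 - verblunsky Φ n ^ 2))) * reciprocal Φ n := by
    rw [hΦ.X_sq_mul_derivative_reciprocal]
    simp only [laxMatrix, weightLogDeriv, Matrix.of_apply, Matrix.cons_val, Nat.cast_succ, C_neg,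
      C_mul, C_sub, C_add, C_1, C_pow]
    ring
  rw [hpoly, G_succ, GStar_eq]
  simp only [weightedCauchy_add hν hz, weightedCauchy_C_mul, weightedCauchy_X_mul hν hz, horth,
    dualLaxMatrix, laxMatrix, Matrix.of_apply, Matrix.cons_val, eval_neg, eval_mul, eval_add,
    eval_sub, eval_C, eval_X]
  linear_combination -(2 * (Real.pi : ℂ))⁻¹ * hpairing

theorem isSystemSolution_G (hΦ : IsMonicOPUC (weight ℓ) Φ κ) (n : ℕ) :
    IsSystemSolution (dualLaxMatrix ℓ Φ n) (Metric.sphere 0 1)ᶜ (G (weight ℓ) Φ (n + 1))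
      (GStar (weight ℓ) Φ n) where
  diff_left := G_succ (weight ℓ) Φ n ▸
    differentiableOn_weightedCauchy (circleIntegrable_weight ℓ) _ _
  diff_right := GStar_eq (weight ℓ) Φ n ▸
    differentiableOn_weightedCauchy (circleIntegrable_weight ℓ) _ _
  sq_mul_deriv_left z hz := by
    obtain ⟨v, hv, hzv⟩ := hasDerivAt_weightedCauchy
      (fun _ ht => hasDerivAt_weight ℓ (ne_zero_of_mem_sphere ht)) hz n (Φ (n + 1))
    rw [← hΦ.weightedCauchy_derivative_succ hz, G_succ, hv.deriv, hzv,
      hΦ.pairing_right_eq_zero (circleIntegrable_weight ℓ)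
        ((natDegree_X_pow_le n).trans_lt n.lt_succ_self), mul_zero, add_zero, weightLogDeriv]
  sq_mul_deriv_right z hz := by
    obtain ⟨v, hv, hzv⟩ := hasDerivAt_weightedCauchy
      (fun _ ht => hasDerivAt_weight ℓ (ne_zero_of_mem_sphere ht)) hz n (reciprocal Φ n)
    rw [← hΦ.weightedCauchy_derivative_reciprocal hz, GStar_eq, hv.deriv, hzv, weightLogDeriv]

end IsMonicOPUC

/-! ### The scalar differential relations -/

theorem deriv_deriv_eval (P : ℂ[X]) (z : ℂ) :
    deriv (deriv fun w => P.eval w) z = (derivative (derivative P)).eval z := by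
  have h : (deriv fun w => P.eval w) = fun w => (derivative P).eval w := funext fun _ => P.deriv
  rw [h, Polynomial.deriv]

namespace IsMonicOPUC

variable {ℓ : ℝ} {Φ : ℕ → ℂ[X]} {κ : ℕ → ℝ} {z : ℂ}

theorem sq_mul_eval_derivative (hΦ : IsMonicOPUC (weight ℓ) Φ κ) (n : ℕ) (z : ℂ) :
    z ^ 2 * (derivative (Φ (n + 1))).eval z =
      ((n + 1) * z + ℓ / 2 - ℓ / 2 * verblunsky Φ n ^ 2) * (Φ (n + 1)).eval z +
        ℓ / 2 * bCoeff κ n * (bCoeff κ (n + 1))⁻¹ *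
          (verblunsky Φ n - verblunsky Φ (n + 1) * z) * (reciprocal Φ n).eval z := by
  have h := (hΦ.isSystemSolution_eval n).sq_mul_deriv_left z trivial
  simp only [Polynomial.deriv, laxMatrix, Matrix.of_apply, Matrix.cons_val, eval_add, eval_sub,
    eval_mul, eval_C, eval_X] at h
  rw [mul_assoc (ℓ / 2 : ℂ), hΦ.bCoeff_mul_inv_bCoeff_succ_weight]
  linear_combination h

theorem sq_mul_deriv_G (hΦ : IsMonicOPUC (weight ℓ) Φ κ) (n : ℕ) (hz : z ∉ Metric.sphere 0 1) :
    z ^ 2 * deriv (G (weight ℓ) Φ (n + 1)) z =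
      (ℓ / 2 * z ^ 2 - ℓ / 2 * verblunsky Φ n ^ 2) * G (weight ℓ) Φ (n + 1) z +
        ℓ / 2 * bCoeff κ n * (bCoeff κ (n + 1))⁻¹ *
          (verblunsky Φ n - verblunsky Φ (n + 1) * z) * GStar (weight ℓ) Φ n z := by
  have h := (hΦ.isSystemSolution_G n).sq_mul_deriv_left z hz
  simp only [dualLaxMatrix, laxMatrix, Matrix.of_apply, Matrix.cons_val, eval_neg, eval_sub,
    eval_mul, eval_pow, eval_C, eval_X] at h
  rw [mul_assoc (ℓ / 2 : ℂ), hΦ.bCoeff_mul_inv_bCoeff_succ_weight]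
  linear_combination h

theorem sq_mul_eval_derivative_reciprocal (hΦ : IsMonicOPUC (weight ℓ) Φ κ) (n : ℕ) (z : ℂ) :
    z ^ 2 * (derivative (reciprocal Φ n)).eval z =
      ℓ / 2 * (verblunsky Φ n - verblunsky Φ (n - 1) * z) * (Φ (n + 1)).eval z +
        (-(ℓ / 2) * z ^ 2 + ℓ / 2 * verblunsky Φ n ^ 2) * (reciprocal Φ n).eval z := by
  have h := (hΦ.isSystemSolution_eval n).sq_mul_deriv_right z trivial
  simp only [Polynomial.deriv, laxMatrix, Matrix.of_apply, Matrix.cons_val, eval_sub, eval_mul,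
    eval_pow, eval_C, eval_X] at h
  linear_combination h

theorem sq_mul_deriv_GStar (hΦ : IsMonicOPUC (weight ℓ) Φ κ) (n : ℕ) (hz : z ∉ Metric.sphere 0 1) :
    z ^ 2 * deriv (GStar (weight ℓ) Φ n) z =
      ℓ / 2 * (verblunsky Φ n - verblunsky Φ (n - 1) * z) * G (weight ℓ) Φ (n + 1) z +
        (-((n + 1) * z) - ℓ / 2 + ℓ / 2 * verblunsky Φ n ^ 2) * GStar (weight ℓ) Φ n z := by
  have h := (hΦ.isSystemSolution_G n).sq_mul_deriv_right z hz
  simp only [dualLaxMatrix, laxMatrix, Matrix.of_apply, Matrix.cons_val, eval_neg, eval_add,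
    eval_sub, eval_mul, eval_C, eval_X] at h
  linear_combination h

theorem sq_mul_eval_derivative_derivative (hΦ : IsMonicOPUC (weight ℓ) Φ κ) (n : ℕ) (z : ℂ) :
    z ^ 2 * (derivative (derivative (Φ (n + 1)))).eval z +
        (ℓ / 2 * z ^ 2 + (2 - (n + 1)) * z - ℓ / 2) * (derivative (Φ (n + 1))).eval z +
        (-(ℓ * (n + 1) / 2 * z) - ℓ ^ 2 / 4 - (n + 1) -
          ℓ ^ 2 / 4 * ((1 - verblunsky Φ n ^ 2) * verblunsky Φ (n + 1) * verblunsky Φ (n - 1) -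
            verblunsky Φ n ^ 2)) * (Φ (n + 1)).eval z =
      -(ℓ / 2) * (1 - verblunsky Φ n ^ 2) * verblunsky Φ (n + 1) * (reciprocal Φ n).eval z := by
  have h := (hΦ.isSystemSolution_eval n).sq_mul_deriv_deriv_left isOpen_univ (hΦ.det_laxMatrix n)
    (Set.mem_univ z)
  rw [deriv_deriv_eval, Polynomial.deriv, trace_laxMatrix] at h
  simp only [laxMatrix, laxDetQuotient, weightLogDeriv, Matrix.of_apply, Matrix.cons_val,
    Nat.cast_succ, derivative_add, derivative_sub, derivative_mul, derivative_C, derivative_X,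
    eval_add, eval_sub, eval_neg, eval_mul, eval_pow, eval_C, eval_X, eval_one, eval_zero] at h
  linear_combination h

theorem sq_mul_deriv_deriv_G (hΦ : IsMonicOPUC (weight ℓ) Φ κ) (n : ℕ)
    (hz : z ∉ Metric.sphere 0 1) :
    z ^ 2 * deriv (deriv (G (weight ℓ) Φ (n + 1))) z +
        (-(ℓ / 2 * z ^ 2) + (n + 1 + 2) * z + ℓ / 2) * deriv (G (weight ℓ) Φ (n + 1)) z -
        (ℓ * ((n + 1) / 2 + 1) * z + ℓ ^ 2 / 4 +
          ℓ ^ 2 / 4 * ((1 - verblunsky Φ n ^ 2) * verblunsky Φ (n + 1) * verblunsky Φ (n - 1) -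
            verblunsky Φ n ^ 2)) * G (weight ℓ) Φ (n + 1) z =
      -(ℓ / 2) * (1 - verblunsky Φ n ^ 2) * verblunsky Φ (n + 1) * GStar (weight ℓ) Φ n z := by
  have h := (hΦ.isSystemSolution_G n).sq_mul_deriv_deriv_left Metric.isClosed_sphere.isOpen_compl
    ((det_dualLaxMatrix ℓ Φ n).trans (hΦ.det_laxMatrix n)) hz
  rw [trace_dualLaxMatrix] at h
  simp only [dualLaxMatrix, laxMatrix, laxDetQuotient, weightLogDeriv, Matrix.of_apply,
    Matrix.cons_val, Nat.cast_succ, derivative_neg, derivative_sub, derivative_mul, derivative_C,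
    derivative_X, derivative_X_pow, eval_add, eval_sub, eval_neg, eval_mul, eval_pow, eval_C,
    eval_X, eval_one, eval_zero] at h
  linear_combination h

theorem sq_mul_eval_derivative_derivative_reciprocal (hΦ : IsMonicOPUC (weight ℓ) Φ κ) (n : ℕ)
    (z : ℂ) :
    z ^ 2 * (derivative (derivative (reciprocal Φ n))).eval z +
        (ℓ / 2 * z ^ 2 + (2 - (n + 1)) * z - ℓ / 2) * (derivative (reciprocal Φ n)).eval z -
        (ℓ * ((n + 1) / 2 - 1) * z + ℓ ^ 2 / 4 +
          ℓ ^ 2 / 4 * ((1 - verblunsky Φ n ^ 2) * verblunsky Φ (n + 1) * verblunsky Φ (n - 1) -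
            verblunsky Φ n ^ 2)) * (reciprocal Φ n).eval z =
      -(ℓ / 2) * verblunsky Φ (n - 1) * (Φ (n + 1)).eval z := by
  have h := (hΦ.isSystemSolution_eval n).sq_mul_deriv_deriv_right isOpen_univ (hΦ.det_laxMatrix n)
    (Set.mem_univ z)
  rw [deriv_deriv_eval, Polynomial.deriv, trace_laxMatrix] at h
  simp only [laxMatrix, laxDetQuotient, weightLogDeriv, Matrix.of_apply, Matrix.cons_val,
    Nat.cast_succ, derivative_sub, derivative_mul, derivative_C, derivative_X, derivative_X_pow,
    eval_add, eval_sub, eval_neg, eval_mul, eval_pow, eval_C, eval_X, eval_one, eval_zero] at h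
  linear_combination h

theorem sq_mul_deriv_deriv_GStar (hΦ : IsMonicOPUC (weight ℓ) Φ κ) (n : ℕ)
    (hz : z ∉ Metric.sphere 0 1) :
    z ^ 2 * deriv (deriv (GStar (weight ℓ) Φ n)) z +
        (-(ℓ / 2 * z ^ 2) + (n + 1 + 2) * z + ℓ / 2) * deriv (GStar (weight ℓ) Φ n) z -
        (ℓ * (n + 1) / 2 * z + ℓ ^ 2 / 4 - (n + 1) +
          ℓ ^ 2 / 4 * ((1 - verblunsky Φ n ^ 2) * verblunsky Φ (n + 1) * verblunsky Φ (n - 1) -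
            verblunsky Φ n ^ 2)) * GStar (weight ℓ) Φ n z =
      -(ℓ / 2) * verblunsky Φ (n - 1) * G (weight ℓ) Φ (n + 1) z := by
  have h := (hΦ.isSystemSolution_G n).sq_mul_deriv_deriv_right Metric.isClosed_sphere.isOpen_compl
    ((det_dualLaxMatrix ℓ Φ n).trans (hΦ.det_laxMatrix n)) hz
  rw [trace_dualLaxMatrix] at h
  simp only [dualLaxMatrix, laxMatrix, laxDetQuotient, weightLogDeriv, Matrix.of_apply,
    Matrix.cons_val, Nat.cast_succ, derivative_neg, derivative_add, derivative_sub, derivative_mul,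
    derivative_C, derivative_X, eval_add, eval_sub, eval_neg, eval_mul, eval_pow, eval_C, eval_X,
    eval_one, eval_zero] at h
  linear_combination h

end IsMonicOPUC

/-! ### Matrix functions -/

section MatrixFunction

variable {F H : ℂ → Matrix (Fin 2) (Fin 2) ℂ} {U : Set ℂ} {z : ℂ}

theorem mderiv_eq_of_eqOn (hU : IsOpen U) (hz : z ∈ U) (h : Set.EqOn F H U) :
    mderiv F z = mderiv H z := by
  ext i j
  exact Filter.EventuallyEq.deriv_eq
    (Filter.eventually_of_mem (hU.mem_nhds hz) fun w hw => congrFun₂ (h hw) i j)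

theorem mderiv_add (hF : ∀ i j, DifferentiableAt ℂ (F · i j) z)
    (hH : ∀ i j, DifferentiableAt ℂ (H · i j) z) :
    mderiv (fun w => F w + H w) z = mderiv F z + mderiv H z := by
  ext i j
  exact deriv_fun_add (hF i j) (hH i j)

theorem mderiv_mul (hF : ∀ i j, DifferentiableAt ℂ (F · i j) z)
    (hH : ∀ i j, DifferentiableAt ℂ (H · i j) z) :
    mderiv (fun w => F w * H w) z = mderiv F z * H z + F z * mderiv H z := by
  ext i j
  simp only [mderiv, Matrix.of_apply, Matrix.mul_apply, Matrix.add_apply, ← Finset.sum_add_distrib]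
  rw [deriv_fun_sum fun k _ => (hF i k).fun_mul (hH k j)]
  exact Finset.sum_congr rfl fun k _ => deriv_fun_mul (hF i k) (hH k j)

theorem differentiableOn_mul_apply (hF : ∀ i j, DifferentiableOn ℂ (F · i j) U)
    (hH : ∀ i j, DifferentiableOn ℂ (H · i j) U) (i j : Fin 2) :
    DifferentiableOn ℂ (fun w => (F w * H w) i j) U := by
  simp only [Matrix.mul_apply]
  exact .fun_sum fun k _ => (hF i k).mul (hH k j)

theorem mderiv_sq_smul (hF : ∀ i j, DifferentiableAt ℂ (F · i j) z) :
    mderiv (fun w => w ^ 2 • F w) z = (2 * z) • F z + z ^ 2 • mderiv F z := by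
  ext i j
  refine (((hasDerivAt_pow 2 z).mul (hF i j).hasDerivAt).deriv).trans ?_
  simp [mderiv]

theorem mderiv_mderiv_mul (hU : IsOpen U) (hF : ∀ i j, DifferentiableOn ℂ (F · i j) U)
    (hH : ∀ i j, DifferentiableOn ℂ (H · i j) U) (hz : z ∈ U) :
    mderiv (mderiv fun w => F w * H w) z =
      mderiv (mderiv F) z * H z + 2 • (mderiv F z * mderiv H z) + F z * mderiv (mderiv H) z := by
  have diffAt {A : ℂ → Matrix (Fin 2) (Fin 2) ℂ} (hA : ∀ i j, DifferentiableOn ℂ (A · i j) U)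
      {w : ℂ} (hw : w ∈ U) (i j : Fin 2) : DifferentiableAt ℂ (A · i j) w :=
    (hA i j).differentiableAt (hU.mem_nhds hw)
  have hF' (i j) : DifferentiableOn ℂ (mderiv F · i j) U := (hF i j).deriv hU
  have hH' (i j) : DifferentiableOn ℂ (mderiv H · i j) U := (hH i j).deriv hU
  have mul_apply_diff {A B : ℂ → Matrix (Fin 2) (Fin 2) ℂ}
      (hA : ∀ i j, DifferentiableOn ℂ (A · i j) U) (hB : ∀ i j, DifferentiableOn ℂ (B · i j) U) :=
    fun i j => (differentiableOn_mul_apply hA hB i j).differentiableAt (hU.mem_nhds hz)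
  rw [mderiv_eq_of_eqOn hU hz fun w hw => mderiv_mul (diffAt hF hw) (diffAt hH hw),
    mderiv_add (mul_apply_diff hF' hH) (mul_apply_diff hF hH'),
    mderiv_mul (diffAt hF' hz) (diffAt hH hz), mderiv_mul (diffAt hF hz) (diffAt hH' hz), two_smul]
  abel

theorem sq_smul_mderiv_mderiv_of_eqOn {L : ℂ → Matrix (Fin 2) (Fin 2) ℂ} (hU : IsOpen U)
    (hF : ∀ i j, DifferentiableOn ℂ (F · i j) U)
    (hL : ∀ i j, DifferentiableAt ℂ (L · i j) z) (hz : z ∈ U) (h0 : z ≠ 0)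
    (h : ∀ w ∈ U, w ^ 2 • mderiv F w = L w * F w) :
    z ^ 2 • mderiv (mderiv F) z + (2 * z) • mderiv F z =
      (mderiv L z + (z ^ 2)⁻¹ • L z ^ 2) * F z := by
  have hFz (i j) : DifferentiableAt ℂ (F · i j) z := (hF i j).differentiableAt (hU.mem_nhds hz)
  have hF'z (i j) : DifferentiableAt ℂ (mderiv F · i j) z :=
    ((hF i j).deriv hU).differentiableAt (hU.mem_nhds hz)
  have hF' : mderiv F z = (z ^ 2)⁻¹ • (L z * F z) := by
    rw [← h z hz, inv_smul_smul₀ (pow_ne_zero 2 h0)]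
  rw [add_comm, ← mderiv_sq_smul hF'z, mderiv_eq_of_eqOn hU hz h, mderiv_mul hL hFz, hF',
    Matrix.mul_smul, ← mul_assoc, ← sq, ← Matrix.smul_mul, add_mul]

end MatrixFunction

/-! ### The matrix equations -/

theorem hasDerivAt_of_sq_eventuallyEq {c m : ℂ → ℂ} {a z : ℂ} (hc : DifferentiableAt ℂ c z)
    (hsq : (fun w => c w ^ 2) =ᶠ[𝓝 z] m) (hm : HasDerivAt m (a * m z) z) (h0 : c z ≠ 0) :
    HasDerivAt c (a / 2 * c z) z := by
  have h := (hc.hasDerivAt.fun_pow 2).unique (hm.congr_of_eventuallyEq hsq)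
  rw [← hsq.eq_of_nhds] at h
  refine hc.hasDerivAt.congr_deriv (mul_left_cancel₀ h0 ?_)
  simp only [Nat.cast_ofNat, Nat.add_one_sub_one, pow_one] at h
  linear_combination h / 2

namespace IsBranchPair

variable {ℓ : ℝ} {U : Set ℂ} {ρ σ : ℂ → ℂ} {z : ℂ}

theorem ne_zero_left {ν : ℂ → ℂ} (h : IsBranchPair ν U ρ σ) (hz : z ∈ U) (h0 : z ≠ 0) :
    ρ z ≠ 0 := by
  intro hρ
  exact h0 (by rw [← h.sq_left z hz, hρ, zero_pow two_ne_zero])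

theorem ne_zero_right (h : IsBranchPair (weight ℓ) U ρ σ) (hz : z ∈ U) : σ z ≠ 0 := by
  intro hσ
  refine Complex.exp_ne_zero ((ℓ : ℂ) * (z + z⁻¹) / 2) ?_
  rw [← weight, ← h.sq_right z hz, hσ, zero_pow two_ne_zero]

theorem div_pow_ne_zero (h : IsBranchPair (weight ℓ) U ρ σ) (hz : z ∈ U) (h0 : z ≠ 0) (n : ℕ) :
    σ z / ρ z ^ n ≠ 0 :=
  div_ne_zero (h.ne_zero_right hz) (pow_ne_zero n (h.ne_zero_left hz h0))

theorem hasDerivAt_div_pow (h : IsBranchPair (weight ℓ) U ρ σ) (hz : z ∈ U) (h0 : z ≠ 0) (n : ℕ) :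
    HasDerivAt (fun w => σ w / ρ w ^ (n + 1))
      ((weightLogDeriv ℓ n).eval z / z ^ 2 / 2 * (σ z / ρ z ^ (n + 1))) z := by
  have hUz := h.isOpen.mem_nhds hz
  refine hasDerivAt_of_sq_eventuallyEq ?_ ?_
    (ModifiedBessel.hasDerivAt_div_pow (hasDerivAt_weight ℓ h0) h0 (n + 1))
    (h.div_pow_ne_zero hz h0 (n + 1))
  · exact (h.diff_right.differentiableAt hUz).div ((h.diff_left.differentiableAt hUz).pow _)
      (pow_ne_zero _ (h.ne_zero_left hz h0))
  · filter_upwards [hUz] with w hw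
    rw [div_pow, h.sq_right w hw, ← pow_mul, mul_comm, pow_mul, h.sq_left w hw]

theorem det_CMat (h : IsBranchPair (weight ℓ) U ρ σ) (hz : z ∈ U) (h0 : z ≠ 0) (n : ℕ) :
    (CMat ρ σ n z).det = 1 := by
  rw [CMat, Matrix.det_fin_two_of, mul_zero, sub_zero, ← inv_div (σ z),
    mul_inv_cancel₀ (h.div_pow_ne_zero hz h0 n)]

theorem isUnit_det_CMat (h : IsBranchPair (weight ℓ) U ρ σ) (hz : z ∈ U) (h0 : z ≠ 0) (n : ℕ) :
    IsUnit (CMat ρ σ n z).det :=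
  h.det_CMat hz h0 n ▸ isUnit_one

theorem differentiableOn_CMat (h : IsBranchPair (weight ℓ) U ρ σ) (h0 : ∀ z ∈ U, z ≠ 0) (n : ℕ)
    (i j : Fin 2) : DifferentiableOn ℂ (CMat ρ σ n · i j) U := by
  have hρ := h.diff_left.fun_pow n
  have hρn (z) (hz : z ∈ U) : ρ z ^ n ≠ 0 := pow_ne_zero n (h.ne_zero_left hz (h0 z hz))
  fin_cases i <;> fin_cases j
  · exact h.diff_right.fun_div hρ hρn
  · exact differentiableOn_const 0
  · exact differentiableOn_const 0
  · exact hρ.fun_div h.diff_right fun z hz => h.ne_zero_right hz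

theorem sq_smul_mderiv_CMat (h : IsBranchPair (weight ℓ) U ρ σ) (hz : z ∈ U) (h0 : z ≠ 0) (n : ℕ) :
    z ^ 2 • mderiv (CMat ρ σ (n + 1)) z =
      ((weightLogDeriv ℓ n).eval z / 2) • (!![1, 0; 0, -1] * CMat ρ σ (n + 1) z) := by
  have hc := h.hasDerivAt_div_pow hz h0 n
  have hne := h.div_pow_ne_zero hz h0 (n + 1)
  have hinv : deriv (fun w => ρ w ^ (n + 1) / σ w) z =
      -((weightLogDeriv ℓ n).eval z / z ^ 2 / 2) * (ρ z ^ (n + 1) / σ z) := by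
    have h := (hc.fun_inv hne).deriv
    simp only [inv_div] at h
    rw [h, ← inv_div (σ z)]
    field_simp
  ext i j
  fin_cases i <;> fin_cases j <;>
    simp only [mderiv, CMat, Matrix.smul_apply, Matrix.mul_apply, Fin.sum_univ_two, Matrix.of_apply,
      Matrix.cons_val, Fin.zero_eta, Fin.mk_one, smul_eq_mul, hc.deriv, hinv, deriv_const]
  · field_simp
    ring
  · ring
  · ring
  · field_simp
    ring

theorem sq_smul_mderiv_CMat_mul_inv (h : IsBranchPair (weight ℓ) U ρ σ) (hz : z ∈ U) (h0 : z ≠ 0)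
    (n : ℕ) :
    z ^ 2 • (mderiv (CMat ρ σ (n + 1)) z * (CMat ρ σ (n + 1) z)⁻¹) =
      ((weightLogDeriv ℓ n).eval z / 2) • !![1, 0; 0, -1] := by
  rw [← Matrix.smul_mul, h.sq_smul_mderiv_CMat hz h0, Matrix.smul_mul,
    Matrix.mul_nonsing_inv_cancel_right _ _ (h.isUnit_det_CMat hz h0 (n + 1))]

end IsBranchPair

theorem differentiable_MTilde (ℓ : ℝ) (Φ : ℕ → ℂ[X]) (κ : ℕ → ℝ) (n : ℕ) (i j : Fin 2) :
    Differentiable ℂ (MTilde ℓ Φ κ n · i j) := by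
  fin_cases i <;> fin_cases j <;>
    simp only [MTilde, Matrix.of_apply, Matrix.cons_val, Fin.zero_eta, Fin.mk_one] <;> fun_prop

namespace IsMonicOPUC

variable {ℓ : ℝ} {Φ : ℕ → ℂ[X]} {κ : ℕ → ℝ} {U : Set ℂ} {ρ σ : ℂ → ℂ} {z : ℂ}

theorem differentiableOn_Y (hΦ : IsMonicOPUC (weight ℓ) Φ κ) (n : ℕ) (i j : Fin 2) :
    DifferentiableOn ℂ (Y (weight ℓ) Φ κ (n + 1) · i j) (Metric.sphere 0 1)ᶜ := by
  have hG := hΦ.isSystemSolution_G n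
  fin_cases i <;> fin_cases j
  · exact (Φ (n + 1)).differentiable.differentiableOn
  · exact hG.diff_left
  · exact (reciprocal Φ n).differentiable.differentiableOn.const_mul _
  · exact hG.diff_right.const_mul _

theorem sq_smul_mderiv_Y (hΦ : IsMonicOPUC (weight ℓ) Φ κ) (n : ℕ) (hz : z ∉ Metric.sphere 0 1) :
    z ^ 2 • mderiv (Y (weight ℓ) Φ κ (n + 1)) z =
      MTilde ℓ Φ κ (n + 1) z * Y (weight ℓ) Φ κ (n + 1) z -
        ((weightLogDeriv ℓ n).eval z / 2) • (Y (weight ℓ) Φ κ (n + 1) z * !![1, 0; 0, -1]) := by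
  have hΦ' := hΦ.sq_mul_eval_derivative n z
  have hG' := hΦ.sq_mul_deriv_G n hz
  have hΦs' := hΦ.sq_mul_eval_derivative_reciprocal n z
  have hGs' := hΦ.sq_mul_deriv_GStar n hz
  have hpred : (n : ℤ) + 1 - 2 = n - 1 := by ring
  have hb := hΦ.bCoeff_mul_inv_bCoeff_succ_weight n
  ext i j
  fin_cases i <;> fin_cases j <;>
    simp only [mderiv, Y, MTilde, weightLogDeriv, Matrix.of_apply, Matrix.cons_val,
      Matrix.mul_apply, Fin.sum_univ_two, Matrix.smul_apply, Matrix.sub_apply, smul_eq_mul,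
      Fin.zero_eta, Fin.mk_one, deriv_const_mul_field', Polynomial.deriv, Nat.add_sub_cancel,
      Nat.cast_succ, add_sub_cancel_right, hpred, eval_sub, eval_mul, eval_C, eval_pow, eval_X,
      eval_one]
  · linear_combination hΦ' - ℓ / 4 * (Φ (n + 1)).eval z * hb
  · linear_combination hG' - ℓ / 4 * G (weight ℓ) Φ (n + 1) z * hb
  · linear_combination -bCoeff κ n * hΦs' - ℓ / 4 * bCoeff κ n * (reciprocal Φ n).eval z * hb
  · linear_combination -bCoeff κ n * hGs' - ℓ / 4 * bCoeff κ n * GStar (weight ℓ) Φ n z * hb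

variable (hΦ : IsMonicOPUC (weight ℓ) Φ κ) (hbr : IsBranchPair (weight ℓ) U ρ σ)
  (hU : U ⊆ (Metric.sphere 0 1 ∪ {0})ᶜ) (hz : z ∈ U)
include hΦ hbr hU hz

theorem sq_smul_mderiv_Z (n : ℕ) :
    z ^ 2 • mderiv (Z (weight ℓ) Φ κ ρ σ (n + 1)) z =
      MTilde ℓ Φ κ (n + 1) z * Z (weight ℓ) Φ κ ρ σ (n + 1) z := by
  have hzU := hU hz
  rw [Set.mem_compl_iff, Set.mem_union, not_or] at hzU
  have hY (i j) := (hΦ.differentiableOn_Y n i j).differentiableAt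
    (Metric.isClosed_sphere.isOpen_compl.mem_nhds hzU.1)
  have hC (i j) := (hbr.differentiableOn_CMat (fun w hw h => (hU hw) (.inr h)) (n + 1) i j
    ).differentiableAt (hbr.isOpen.mem_nhds hz)
  unfold Z
  rw [mderiv_mul hY hC, smul_add, ← Matrix.smul_mul, ← Matrix.mul_smul,
    hΦ.sq_smul_mderiv_Y n hzU.1, hbr.sq_smul_mderiv_CMat hz hzU.2, Matrix.sub_mul,
    Matrix.mul_smul, Matrix.smul_mul, mul_assoc, mul_assoc, sub_add_cancel]

theorem det_Z (n : ℕ) : (Z (weight ℓ) Φ κ ρ σ (n + 1) z).det = 1 := by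
  have hzU := hU hz
  rw [Set.mem_compl_iff, Set.mem_union, not_or] at hzU
  rw [Z, Matrix.det_mul, hΦ.det_Y_succ (circleIntegrable_weight ℓ) hzU.1,
    hbr.det_CMat hz hzU.2, mul_one]

theorem sq_smul_M (n : ℕ) :
    z ^ 2 • M (weight ℓ) Φ κ ρ σ (n + 1) z = MTilde ℓ Φ κ (n + 1) z := by
  rw [M, ← Matrix.smul_mul, hΦ.sq_smul_mderiv_Z hbr hU hz,
    Matrix.mul_nonsing_inv_cancel_right _ _ (hΦ.det_Z hbr hU hz n ▸ isUnit_one)]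

theorem sq_smul_mderiv_Y_eq_sub (n : ℕ) :
    z ^ 2 • mderiv (Y (weight ℓ) Φ κ (n + 1)) z =
      MTilde ℓ Φ κ (n + 1) z * Y (weight ℓ) Φ κ (n + 1) z -
        z ^ 2 • (Y (weight ℓ) Φ κ (n + 1) z * mderiv (CMat ρ σ (n + 1)) z *
          (CMat ρ σ (n + 1) z)⁻¹) := by
  have hzU := hU hz
  rw [Set.mem_compl_iff, Set.mem_union, not_or] at hzU
  rw [hΦ.sq_smul_mderiv_Y n hzU.1, mul_assoc, ← Matrix.mul_smul _ (z ^ 2),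
    hbr.sq_smul_mderiv_CMat_mul_inv hz hzU.2, Matrix.mul_smul]

theorem sq_smul_mderiv_mderiv_Y (n : ℕ) :
    z ^ 2 • mderiv (mderiv (Y (weight ℓ) Φ κ (n + 1))) z +
        2 • (mderiv (Y (weight ℓ) Φ κ (n + 1)) z *
          (z ^ 2 • (mderiv (CMat ρ σ (n + 1)) z * (CMat ρ σ (n + 1) z)⁻¹) + z • 1)) +
        Y (weight ℓ) Φ κ (n + 1) z *
          (z ^ 2 • (mderiv (mderiv (CMat ρ σ (n + 1))) z * (CMat ρ σ (n + 1) z)⁻¹) +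
            (2 * z) • (mderiv (CMat ρ σ (n + 1)) z * (CMat ρ σ (n + 1) z)⁻¹)) =
      (mderiv (MTilde ℓ Φ κ (n + 1)) z + (z ^ 2)⁻¹ • MTilde ℓ Φ κ (n + 1) z ^ 2) *
        Y (weight ℓ) Φ κ (n + 1) z := by
  have hzU := hU hz
  rw [Set.mem_compl_iff, Set.mem_union, not_or] at hzU
  have hC := hbr.differentiableOn_CMat (fun w hw h => (hU hw) (.inr h)) (n + 1)
  have hY (i j) := (hΦ.differentiableOn_Y n i j).mono fun w hw h => (hU hw) (.inl h)
  have hZ := sq_smul_mderiv_mderiv_of_eqOn hbr.isOpen (differentiableOn_mul_apply hY hC)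
    (fun i j => (differentiable_MTilde ℓ Φ κ (n + 1) i j).differentiableAt) hz hzU.2
    fun w hw => hΦ.sq_smul_mderiv_Z hbr hU hw n
  rw [mderiv_mderiv_mul hbr.isOpen hY hC hz, mderiv_mul
    (fun i j => (hY i j).differentiableAt (hbr.isOpen.mem_nhds hz))
    (fun i j => (hC i j).differentiableAt (hbr.isOpen.mem_nhds hz)), ← mul_assoc] at hZ
  have hunit := hbr.isUnit_det_CMat hz hzU.2 (n + 1)
  rw [← Matrix.mul_nonsing_inv_cancel_right _ (_ * Y (weight ℓ) Φ κ (n + 1) z) hunit, ← hZ]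
  simp only [Matrix.add_mul, Matrix.mul_add, Matrix.smul_mul, Matrix.mul_smul, smul_add, mul_assoc,
    Matrix.mul_nonsing_inv _ hunit, mul_one, two_smul, two_mul, add_smul]
  abel

end IsMonicOPUC

end ModifiedBessel

end

open ModifiedBessel Polynomial in
theorem mainTheorem8_general (ℓ : ℝ) (Φ : ℕ → ℂ[X]) (κ : ℕ → ℝ)
    (hΦ : IsMonicOPUC (weight ℓ) Φ κ)
    (α : ℤ → ℂ) (hα : α = verblunsky Φ) (b : ℕ → ℂ) (hb : b = bCoeff κ)
    (n : ℕ) (hn : 1 ≤ n) :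
    (∀ k : ℤ, -1 ≤ k → (α k).im = 0) ∧
    DifferentiableOn ℂ (G (weight ℓ) Φ n) (Metric.sphere 0 1)ᶜ ∧
    DifferentiableOn ℂ (GStar (weight ℓ) Φ (n - 1)) (Metric.sphere 0 1)ᶜ ∧
    (∀ z : ℂ, z ∉ Metric.sphere (0 : ℂ) 1 → (Y (weight ℓ) Φ κ n z).det = 1) ∧
    (∀ (U : Set ℂ) (ρ σ : ℂ → ℂ), U ⊆ (Metric.sphere 0 1 ∪ {0})ᶜ →
      IsBranchPair (weight ℓ) U ρ σ → ∀ z ∈ U,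
        z ^ 2 • M (weight ℓ) Φ κ ρ σ n z = MTilde ℓ Φ κ n z ∧
        z ^ 2 • mderiv (Y (weight ℓ) Φ κ n) z =
          MTilde ℓ Φ κ n z * Y (weight ℓ) Φ κ n z -
            z ^ 2 • (Y (weight ℓ) Φ κ n z * mderiv (CMat ρ σ n) z * (CMat ρ σ n z)⁻¹) ∧
        z ^ 2 • mderiv (mderiv (Y (weight ℓ) Φ κ n)) z +
            2 • (mderiv (Y (weight ℓ) Φ κ n) z *
              (z ^ 2 • (mderiv (CMat ρ σ n) z * (CMat ρ σ n z)⁻¹) + z • 1)) +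
            Y (weight ℓ) Φ κ n z *
              (z ^ 2 • (mderiv (mderiv (CMat ρ σ n)) z * (CMat ρ σ n z)⁻¹) +
                (2 * z) • (mderiv (CMat ρ σ n) z * (CMat ρ σ n z)⁻¹)) =
          (mderiv (MTilde ℓ Φ κ n) z + (z ^ 2)⁻¹ • MTilde ℓ Φ κ n z ^ 2) *
            Y (weight ℓ) Φ κ n z) ∧
    (∀ z : ℂ,
      z ^ 2 * (derivative (Φ n)).eval z =
        (n * z + ℓ / 2 - ℓ / 2 * α (n - 1) ^ 2) * (Φ n).eval z +
          ℓ / 2 * b (n - 1) * (b n)⁻¹ * (α (n - 1) - α n * z) *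
            (reciprocal Φ (n - 1)).eval z) ∧
    (∀ z : ℂ, z ∉ Metric.sphere (0 : ℂ) 1 →
      z ^ 2 * deriv (G (weight ℓ) Φ n) z =
        (ℓ / 2 * z ^ 2 - ℓ / 2 * α (n - 1) ^ 2) * G (weight ℓ) Φ n z +
          ℓ / 2 * b (n - 1) * (b n)⁻¹ * (α (n - 1) - α n * z) *
            GStar (weight ℓ) Φ (n - 1) z) ∧
    (∀ z : ℂ,
      z ^ 2 * (derivative (reciprocal Φ (n - 1))).eval z =
        ℓ / 2 * (α (n - 1) - α (n - 2) * z) * (Φ n).eval z +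
          (-(ℓ / 2) * z ^ 2 + ℓ / 2 * α (n - 1) ^ 2) * (reciprocal Φ (n - 1)).eval z) ∧
    (∀ z : ℂ, z ∉ Metric.sphere (0 : ℂ) 1 →
      z ^ 2 * deriv (GStar (weight ℓ) Φ (n - 1)) z =
        ℓ / 2 * (α (n - 1) - α (n - 2) * z) * G (weight ℓ) Φ n z +
          (-(n * z) - ℓ / 2 + ℓ / 2 * α (n - 1) ^ 2) * GStar (weight ℓ) Φ (n - 1) z) ∧
    (∀ z : ℂ,
      z ^ 2 * (derivative (derivative (Φ n))).eval z +
          (ℓ / 2 * z ^ 2 + (2 - n) * z - ℓ / 2) * (derivative (Φ n)).eval z +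
          (-(ℓ * n / 2 * z) - ℓ ^ 2 / 4 - n -
            ℓ ^ 2 / 4 * ((1 - α (n - 1) ^ 2) * α n * α (n - 2) - α (n - 1) ^ 2)) *
              (Φ n).eval z =
        -(ℓ / 2) * (1 - α (n - 1) ^ 2) * α n * (reciprocal Φ (n - 1)).eval z) ∧
    (∀ z : ℂ, z ∉ Metric.sphere (0 : ℂ) 1 →
      z ^ 2 * deriv (deriv (G (weight ℓ) Φ n)) z +
          (-(ℓ / 2 * z ^ 2) + (n + 2) * z + ℓ / 2) * deriv (G (weight ℓ) Φ n) z -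
          (ℓ * (n / 2 + 1) * z + ℓ ^ 2 / 4 +
            ℓ ^ 2 / 4 * ((1 - α (n - 1) ^ 2) * α n * α (n - 2) - α (n - 1) ^ 2)) *
              G (weight ℓ) Φ n z =
        -(ℓ / 2) * (1 - α (n - 1) ^ 2) * α n * GStar (weight ℓ) Φ (n - 1) z) ∧
    (∀ z : ℂ,
      z ^ 2 * (derivative (derivative (reciprocal Φ (n - 1)))).eval z +
          (ℓ / 2 * z ^ 2 + (2 - n) * z - ℓ / 2) * (derivative (reciprocal Φ (n - 1))).eval z -
          (ℓ * (n / 2 - 1) * z + ℓ ^ 2 / 4 +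
            ℓ ^ 2 / 4 * ((1 - α (n - 1) ^ 2) * α n * α (n - 2) - α (n - 1) ^ 2)) *
              (reciprocal Φ (n - 1)).eval z =
        -(ℓ / 2) * α (n - 2) * (Φ n).eval z) ∧
    (∀ z : ℂ, z ∉ Metric.sphere (0 : ℂ) 1 →
      z ^ 2 * deriv (deriv (GStar (weight ℓ) Φ (n - 1))) z +
          (-(ℓ / 2 * z ^ 2) + (n + 2) * z + ℓ / 2) * deriv (GStar (weight ℓ) Φ (n - 1)) z -
          (ℓ * n / 2 * z + ℓ ^ 2 / 4 - n +
            ℓ ^ 2 / 4 * ((1 - α (n - 1) ^ 2) * α n * α (n - 2) - α (n - 1) ^ 2)) *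
              GStar (weight ℓ) Φ (n - 1) z =
        -(ℓ / 2) * α (n - 2) * G (weight ℓ) Φ n z) := by
  subst hα hb
  obtain ⟨m, rfl⟩ : ∃ m, n = m + 1 := ⟨n - 1, (Nat.sub_add_cancel hn).symm⟩
  have hpred : (m : ℤ) + 1 - 2 = m - 1 := by ring
  simp only [Nat.add_sub_cancel, Nat.cast_succ, add_sub_cancel_right, hpred]
  exact ⟨fun k _ => Complex.conj_eq_iff_im.1 (hΦ.conj_verblunsky_weight k),
    (hΦ.isSystemSolution_G m).diff_left, (hΦ.isSystemSolution_G m).diff_right,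
    fun z hz => hΦ.det_Y_succ (circleIntegrable_weight ℓ) hz m,
    fun U ρ σ hU hbr z hz => ⟨hΦ.sq_smul_M hbr hU hz m, hΦ.sq_smul_mderiv_Y_eq_sub hbr hU hz m,
      hΦ.sq_smul_mderiv_mderiv_Y hbr hU hz m⟩,
    hΦ.sq_mul_eval_derivative m, fun _ => hΦ.sq_mul_deriv_G m,
    hΦ.sq_mul_eval_derivative_reciprocal m, fun _ => hΦ.sq_mul_deriv_GStar m,
    hΦ.sq_mul_eval_derivative_derivative m, fun _ => hΦ.sq_mul_deriv_deriv_G m,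
    hΦ.sq_mul_eval_derivative_derivative_reciprocal m, fun _ => hΦ.sq_mul_deriv_deriv_GStar m⟩

open ModifiedBessel Polynomial in
theorem mainTheorem8 (ℓ : ℝ) (hℓ : 0 < ℓ) (Φ : ℕ → ℂ[X]) (κ : ℕ → ℝ)
    (hΦ : IsMonicOPUC (weight ℓ) Φ κ)
    (α : ℤ → ℂ) (hα : α = verblunsky Φ) (b : ℕ → ℂ) (hb : b = bCoeff κ)
    (n : ℕ) (hn : 1 ≤ n) :
    -- the Verblunsky coefficients are real
    (∀ k : ℤ, -1 ≤ k → (α k).im = 0) ∧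
    -- `G_n`, `G_{n-1}^*` are holomorphic off the unit circle and `Y_n` is invertible there
    DifferentiableOn ℂ (G (weight ℓ) Φ n) (Metric.sphere 0 1)ᶜ ∧
    DifferentiableOn ℂ (GStar (weight ℓ) Φ (n - 1)) (Metric.sphere 0 1)ᶜ ∧
    (∀ z : ℂ, z ∉ Metric.sphere (0 : ℂ) 1 → (Y (weight ℓ) Φ κ n z).det = 1) ∧
    -- the structure matrix, and the first and second order matrix equations for `Y_n`
    (∀ (U : Set ℂ) (ρ σ : ℂ → ℂ), U ⊆ (Metric.sphere 0 1 ∪ {0})ᶜ →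
      IsBranchPair (weight ℓ) U ρ σ → ∀ z ∈ U,
        z ^ 2 • M (weight ℓ) Φ κ ρ σ n z = MTilde ℓ Φ κ n z ∧
        z ^ 2 • mderiv (Y (weight ℓ) Φ κ n) z =
          MTilde ℓ Φ κ n z * Y (weight ℓ) Φ κ n z -
            z ^ 2 • (Y (weight ℓ) Φ κ n z * mderiv (CMat ρ σ n) z * (CMat ρ σ n z)⁻¹) ∧
        z ^ 2 • mderiv (mderiv (Y (weight ℓ) Φ κ n)) z +
            2 • (mderiv (Y (weight ℓ) Φ κ n) z *
              (z ^ 2 • (mderiv (CMat ρ σ n) z * (CMat ρ σ n z)⁻¹) + z • 1)) +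
            Y (weight ℓ) Φ κ n z *
              (z ^ 2 • (mderiv (mderiv (CMat ρ σ n)) z * (CMat ρ σ n z)⁻¹) +
                (2 * z) • (mderiv (CMat ρ σ n) z * (CMat ρ σ n z)⁻¹)) =
          (mderiv (MTilde ℓ Φ κ n) z + (z ^ 2)⁻¹ • MTilde ℓ Φ κ n z ^ 2) *
            Y (weight ℓ) Φ κ n z) ∧
    -- first order relations
    (∀ z : ℂ,
      z ^ 2 * (derivative (Φ n)).eval z =
        (n * z + ℓ / 2 - ℓ / 2 * α (n - 1) ^ 2) * (Φ n).eval z +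
          ℓ / 2 * b (n - 1) * (b n)⁻¹ * (α (n - 1) - α n * z) *
            (reciprocal Φ (n - 1)).eval z) ∧
    (∀ z : ℂ, z ∉ Metric.sphere (0 : ℂ) 1 →
      z ^ 2 * deriv (G (weight ℓ) Φ n) z =
        (ℓ / 2 * z ^ 2 - ℓ / 2 * α (n - 1) ^ 2) * G (weight ℓ) Φ n z +
          ℓ / 2 * b (n - 1) * (b n)⁻¹ * (α (n - 1) - α n * z) *
            GStar (weight ℓ) Φ (n - 1) z) ∧
    (∀ z : ℂ,
      z ^ 2 * (derivative (reciprocal Φ (n - 1))).eval z =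
        ℓ / 2 * (α (n - 1) - α (n - 2) * z) * (Φ n).eval z +
          (-(ℓ / 2) * z ^ 2 + ℓ / 2 * α (n - 1) ^ 2) * (reciprocal Φ (n - 1)).eval z) ∧
    (∀ z : ℂ, z ∉ Metric.sphere (0 : ℂ) 1 →
      z ^ 2 * deriv (GStar (weight ℓ) Φ (n - 1)) z =
        ℓ / 2 * (α (n - 1) - α (n - 2) * z) * G (weight ℓ) Φ n z +
          (-(n * z) - ℓ / 2 + ℓ / 2 * α (n - 1) ^ 2) * GStar (weight ℓ) Φ (n - 1) z) ∧
    -- second order relations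
    (∀ z : ℂ,
      z ^ 2 * (derivative (derivative (Φ n))).eval z +
          (ℓ / 2 * z ^ 2 + (2 - n) * z - ℓ / 2) * (derivative (Φ n)).eval z +
          (-(ℓ * n / 2 * z) - ℓ ^ 2 / 4 - n -
            ℓ ^ 2 / 4 * ((1 - α (n - 1) ^ 2) * α n * α (n - 2) - α (n - 1) ^ 2)) *
              (Φ n).eval z =
        -(ℓ / 2) * (1 - α (n - 1) ^ 2) * α n * (reciprocal Φ (n - 1)).eval z) ∧
    (∀ z : ℂ, z ∉ Metric.sphere (0 : ℂ) 1 →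
      z ^ 2 * deriv (deriv (G (weight ℓ) Φ n)) z +
          (-(ℓ / 2 * z ^ 2) + (n + 2) * z + ℓ / 2) * deriv (G (weight ℓ) Φ n) z -
          (ℓ * (n / 2 + 1) * z + ℓ ^ 2 / 4 +
            ℓ ^ 2 / 4 * ((1 - α (n - 1) ^ 2) * α n * α (n - 2) - α (n - 1) ^ 2)) *
              G (weight ℓ) Φ n z =
        -(ℓ / 2) * (1 - α (n - 1) ^ 2) * α n * GStar (weight ℓ) Φ (n - 1) z) ∧
    (∀ z : ℂ,
      z ^ 2 * (derivative (derivative (reciprocal Φ (n - 1)))).eval z +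
          (ℓ / 2 * z ^ 2 + (2 - n) * z - ℓ / 2) * (derivative (reciprocal Φ (n - 1))).eval z -
          (ℓ * (n / 2 - 1) * z + ℓ ^ 2 / 4 +
            ℓ ^ 2 / 4 * ((1 - α (n - 1) ^ 2) * α n * α (n - 2) - α (n - 1) ^ 2)) *
              (reciprocal Φ (n - 1)).eval z =
        -(ℓ / 2) * α (n - 2) * (Φ n).eval z) ∧
    (∀ z : ℂ, z ∉ Metric.sphere (0 : ℂ) 1 →
      z ^ 2 * deriv (deriv (GStar (weight ℓ) Φ (n - 1))) z +
          (-(ℓ / 2 * z ^ 2) + (n + 2) * z + ℓ / 2) * deriv (GStar (weight ℓ) Φ (n - 1)) z -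
          (ℓ * n / 2 * z + ℓ ^ 2 / 4 - n +
            ℓ ^ 2 / 4 * ((1 - α (n - 1) ^ 2) * α n * α (n - 2) - α (n - 1) ^ 2)) *
              GStar (weight ℓ) Φ (n - 1) z =
        -(ℓ / 2) * α (n - 2) * G (weight ℓ) Φ n z) :=
  mainTheorem8_general ℓ Φ κ hΦ α hα b hb n hn
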